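/- A \emph{set system} $(U,\mathcal F)$ consists of a finite universe $U$ and a finite collection $\mathcal F$ of subsets of $U$ (repetitions are allowed and counted). A \emph{set cover} is a subcollection of $\mathcal F$ whose union is $U$; it is \emph{minimal} if no proper subcollection of it is a set cover. The set system is given explicitly, by $|U|$, $|\mathcal F|$ and its incidence matrix, and has input size $|U|+|\mathcal F|+|U|\cdot|\mathcal F|$. A \emph{simple branching algorithm} is a program for a random access machine (unit cost per instruction; addition, truncated subtraction, zero tests, indirect addressing) with an additional instruction at which the computation splits into two independent branches, such that every root-to-leaf path of the resulting search tree has length polynomial in the input size, on every input. At each leaf it outputs at most one subcollection of $\mathcal F$. It \emph{enumerates} the minimal set covers of $(U,\mathcal F)$ if every output is a minimal set cover and every minimal set cover is output at one or more leaves. Its \emph{running time} is the sum, over all leaves, of the number of steps on the path from the root to that leaf. \textbf{Theorem.} There is a simple branching algorithm $A$ such that for every real $r>0$ there are $\varepsilon_r>0$ and a polynomial $q_r$ such that, for every set system $(U,\mathcal F)$ with $|U|\le r\cdot|\mathcal F|$ and input size $s$, the algorithm $A$ enumerates all minimal set covers of $(U,\mathcal F)$ in time at most $$q_r(s)\cdot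 2^{(1-\varepsilon_r)\cdot|\mathcal F|},$$ that is, in $O^*\!\left(2^{(1-\varepsilon_r)|\mathcal F|}\right)$ time. -/

import Mathlib

/-! ### Set systems and minimal set covers -/

/-- A finite set system `(U, F)`: the universe is `U = Fin n` and `F` is the collection of the
`m` subsets `sets 0, …, sets (m - 1)` of `U`, so `|U| = n` and `|F| = m`. -/
structure SetSystem where
  n : ℕ
  m : ℕ
  sets : Fin m → Finset (Fin n)

namespace SetSystem

/-- The size of an explicitly given set system: the two sizes and the incidence matrix. -/
def size (I : SetSystem) : ℕ := I.n + I.m + I.n * I.m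

/-- The members of `F` with index in `C` cover the universe. -/
def IsSetCover (I : SetSystem) (C : Finset (Fin I.m)) : Prop :=
  ∀ u : Fin I.n, ∃ i ∈ C, u ∈ I.sets i

/-- An inclusion-wise minimal set cover. -/
def IsMinimalSetCover (I : SetSystem) (C : Finset (Fin I.m)) : Prop :=
  Minimal I.IsSetCover C

end SetSystem

/-! ### Branching random access machines

The machine has registers and arrays of natural numbers, which are named by natural numbers
that are fixed in the program (so a program uses finitely many of them); array entries are
addressed by computed values. Every elementary instruction costs one step; the arithmetic is
addition and truncated subtraction only. The single unusual instruction is `fork`, at which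
the computation continues along two separate branches, each with its own copy of the memory,
so that what happens on one root-to-leaf path never depends on any other path. -/

namespace BranchingRAM

/-- A memory state: `reg x` is the register `x`, and `arr a i` is the entry `i` of array `a`. -/
structure State where
  reg : ℕ → ℕ
  arr : ℕ → ℕ → ℕ

/-- Expressions. -/
inductive Expr where
  | const (c : ℕ)
  | reg (x : ℕ)
  | get (a : ℕ) (i : Expr)
  | add (e f : Expr)
  | sub (e f : Expr)

/-- The value of an expression (`sub` is truncated subtraction). -/
def Expr.eval (s : State) : Expr → ℕ
  | .const c => c
  | .reg x => s.reg x
  | .get a i => s.arr a (i.eval s)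
  | .add e f => e.eval s + f.eval s
  | .sub e f => e.eval s - f.eval s

/-- Programs. The tests of `ifNZ` and `whileNZ` succeed if the expression is nonzero. -/
inductive Prog where
  | assign (x : ℕ) (e : Expr)
  | store (a : ℕ) (i e : Expr)
  | seq (p q : Prog)
  | ifNZ (e : Expr) (p q : Prog)
  | whileNZ (e : Expr) (p : Prog)
  | fork (p q : Prog)

/-- The state after `reg x := v`. -/
def State.assign (s : State) (x v : ℕ) : State :=
  { s with reg := Function.update s.reg x v }

/-- The state after `arr a i := v`. -/
def State.store (s : State) (a i v : ℕ) : State :=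
  { s with arr := Function.update s.arr a (Function.update (s.arr a) i v) }

/-- Search trees: `step` is one deterministic step, `fork` is one branching step, and a leaf
carries the memory state in which the computation halts. -/
inductive SearchTree where
  | leaf (s : State)
  | step (t : SearchTree)
  | fork (t u : SearchTree)

/-- The root-to-leaf paths of a search tree: for each leaf, the number of steps on the path
from the root to it, together with the state at the leaf. -/
def SearchTree.paths : SearchTree → List (ℕ × State)
  | .leaf s => [(0, s)]
  | .step t => t.paths.map fun w => (w.1 + 1, w.2)
  | .fork t u => (t.paths ++ u.paths).map fun w => (w.1 + 1, w.2)

/-- The running time of the exploration of a search tree: the total number of steps on all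
root-to-leaf paths, each explored from scratch. (This is at least the number of nodes
other than the leaves, so sharing common initial segments of paths would only save time.) -/
def SearchTree.time (t : SearchTree) : ℕ := (t.paths.map Prod.fst).sum

/-- `Runs k s t`: the (necessarily finite) search tree of executing the programs in the list
`k` one after another from the memory state `s` is `t`. -/
inductive Runs : List Prog → State → SearchTree → Prop where
  | halt {s : State} : Runs [] s (.leaf s)
  | assign {x : ℕ} {e : Expr} {k : List Prog} {s : State} {t : SearchTree} :
      Runs k (s.assign x (e.eval s)) t → Runs (.assign x e :: k) s (.step t)
  | store {a : ℕ} {i e : Expr} {k : List Prog} {s : State} {t : SearchTree} :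
      Runs k (s.store a (i.eval s) (e.eval s)) t → Runs (.store a i e :: k) s (.step t)
  | seq {p q : Prog} {k : List Prog} {s : State} {t : SearchTree} :
      Runs (p :: q :: k) s t → Runs (.seq p q :: k) s (.step t)
  | ifTrue {e : Expr} {p q : Prog} {k : List Prog} {s : State} {t : SearchTree} :
      e.eval s ≠ 0 → Runs (p :: k) s t → Runs (.ifNZ e p q :: k) s (.step t)
  | ifFalse {e : Expr} {p q : Prog} {k : List Prog} {s : State} {t : SearchTree} :
      e.eval s = 0 → Runs (q :: k) s t → Runs (.ifNZ e p q :: k) s (.step t)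
  | whileTrue {e : Expr} {p : Prog} {k : List Prog} {s : State} {t : SearchTree} :
      e.eval s ≠ 0 → Runs (p :: .whileNZ e p :: k) s t → Runs (.whileNZ e p :: k) s (.step t)
  | whileFalse {e : Expr} {p : Prog} {k : List Prog} {s : State} {t : SearchTree} :
      e.eval s = 0 → Runs k s t → Runs (.whileNZ e p :: k) s (.step t)
  | fork {p q : Prog} {k : List Prog} {s : State} {t u : SearchTree} :
      Runs (p :: k) s t → Runs (q :: k) s u → Runs (.fork p q :: k) s (.fork t u)

/-! ### Set systems as inputs, families of sets as outputs -/

/-- The initial memory: `|U|` in register 0, `|F|` in register 1, and the incidence matrix of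
the set system, row by row, in array 0; everything else is zero. -/
def inputState (I : SetSystem) : State where
  reg x := if x = 0 then I.n else if x = 1 then I.m else 0
  arr a k :=
    if a = 0 ∧ ∃ (i : Fin I.m) (u : Fin I.n), u ∈ I.sets i ∧ k = i.val * I.n + u.val then 1 else 0

/-- `t` is the search tree of the program `A` on the set system `I`. -/
def IsSearchTree (A : Prog) (I : SetSystem) (t : SearchTree) : Prop :=
  Runs [A] (inputState I) t

/-- What a leaf finds: nothing if register 2 is zero, and otherwise the single subfamily of
`F` whose characteristic vector is in array 1. -/
def output (I : SetSystem) (s : State) : Option (Finset (Fin I.m)) :=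
  if s.reg 2 = 0 then none else some (Finset.univ.filter fun i : Fin I.m => s.arr 1 i.val ≠ 0)

/-- The leaves of the search tree enumerate the minimal set covers of `I`: whatever a leaf finds
is a minimal set cover, and every minimal set cover is found at some leaf (duplicates are
allowed). -/
def EnumeratesMinimalSetCovers (I : SetSystem) (t : SearchTree) : Prop :=
  ∀ C : Finset (Fin I.m), (∃ w ∈ t.paths, output I w.2 = some C) ↔ I.IsMinimalSetCover C

/-- A simple branching algorithm: a branching program that halts on every root-to-leaf path,
on every input, after a number of steps that is polynomial in the input size. -/
def IsSimpleBranchingAlgorithm (A : Prog) : Prop :=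
  ∃ q : Polynomial ℕ, ∀ I : SetSystem, ∃ t : SearchTree, IsSearchTree A I t ∧
    ∀ w ∈ t.paths, w.1 ≤ q.eval I.size

end BranchingRAM

/-! The algorithm always decides an undecided set that covers the most new elements. A set that
covers nothing new is discarded, since a member of a minimal cover has a private element. A set that
is the last remaining option of some uncovered element is taken. Otherwise the algorithm branches.
Every minimal cover survives along some path (`GreedyTree.mem_of_isMinimalSetCover`), and each leaf
tests its family for minimality, so only the number of leaves matters.

Write k for the number of undecided sets and call an uncovered element active if some undecided set
contains it. There are at most n ≤ r·m active elements. As long as a greedy choice covers more than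
d new elements, a take lowers the number of active elements by at least d, so it is a rare event
when d is a large multiple of r; the branching factor is then effectively 3/2 instead of 2
(`GreedyTree.length_le_of_low`). This phase either lasts for about half of the sets, which already
saves an exponential factor, or it reaches a state with all degrees at most d and at least about m/2
sets undecided.

In the second situation there are two cases (`exists_length_le_of_degree_le`). If fewer than about
k/4 elements are active, few sets can be taken at all, because each taken set covers something new
(`GreedyTree.length_le_of_active`). If more are active, double counting leaves many elements with at
most 8d options, and a maximal subfamily with pairwise disjoint options has size linear in k
(`exists_disjoint_active`). The forcing rule prevents discarding all options of such an element, so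
each one multiplies the bound by 1 − 2^(−8d) or less (`GreedyTree.length_le_of_disjoint`).

The remaining half implements the procedure on the machine. Deterministic pieces are commands with a
functional semantics and a polynomial cost, the invariant `Rep` ties memory to a pair (D, C), and
the search tree gets exactly the leaves of a `GreedyTree`, each at polynomial depth. -/

namespace SetSystem

/-! ### The greedy branching procedure -/

variable (I : SetSystem)

/-- The number of members of `C` that contain `u`. -/
def hitCount (C : Finset (Fin I.m)) (u : Fin I.n) : ℕ :=
  (C.filter fun i => u ∈ I.sets i).card

/-- The elements of the set `v` that are not covered by `C`. -/
def newly (C : Finset (Fin I.m)) (v : Fin I.m) : Finset (Fin I.n) :=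
  (I.sets v).filter fun u => ∀ i ∈ C, u ∉ I.sets i

/-- The sets outside `D` that contain `u`. -/
def options (D : Finset (Fin I.m)) (u : Fin I.n) : Finset (Fin I.m) :=
  Dᶜ.filter fun i => u ∈ I.sets i

/-- The elements not covered by `C` that some set outside `D` contains. -/
def active (D C : Finset (Fin I.m)) : Finset (Fin I.n) :=
  Finset.univ.filter fun u => (∀ i ∈ C, u ∉ I.sets i) ∧ (I.options D u).Nonempty

/-- Outside `D`, only `v` can cover some element not yet covered by `C`. -/
def Forced (D C : Finset (Fin I.m)) (v : Fin I.m) : Prop :=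
  ∃ u ∈ I.newly C v, (I.options D u).card = 1

/-- `v` is an undecided set with the largest number of uncovered elements. -/
def IsGreedyChoice (D C : Finset (Fin I.m)) (v : Fin I.m) : Prop :=
  v ∉ D ∧ ∀ w, w ∉ D → (I.newly C w).card ≤ (I.newly C v).card

/-- `GreedyTree D C L`: the greedy branching procedure, started when exactly the sets in `D` are
decided and those in `C` are taken, ends with the families in the list `L`. -/
inductive GreedyTree : Finset (Fin I.m) → Finset (Fin I.m) → List (Finset (Fin I.m)) → Prop where
  | leaf {C : Finset (Fin I.m)} : GreedyTree Finset.univ C [C]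
  | skip {D C : Finset (Fin I.m)} {v : Fin I.m} {L : List (Finset (Fin I.m))} :
      I.IsGreedyChoice D C v → (I.newly C v).card = 0 →
      GreedyTree (insert v D) C L → GreedyTree D C L
  | take {D C : Finset (Fin I.m)} {v : Fin I.m} {L : List (Finset (Fin I.m))} :
      I.IsGreedyChoice D C v → I.Forced D C v →
      GreedyTree (insert v D) (insert v C) L → GreedyTree D C L
  | branch {D C : Finset (Fin I.m)} {v : Fin I.m} {L₁ L₀ : List (Finset (Fin I.m))} :
      I.IsGreedyChoice D C v → (I.newly C v).card ≠ 0 → ¬ I.Forced D C v →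
      GreedyTree (insert v D) (insert v C) L₁ → GreedyTree (insert v D) C L₀ →
      GreedyTree D C (L₁ ++ L₀)

variable {I}

/-! ### Completeness of the procedure -/

/-- If every element of `v` lay in another member of `K`, erasing `v` would leave a cover. -/
theorem IsMinimalSetCover.exists_private {K : Finset (Fin I.m)} (hK : I.IsMinimalSetCover K)
    {v : Fin I.m} (hv : v ∈ K) : ∃ u ∈ I.sets v, ∀ i ∈ K, u ∈ I.sets i → i = v := by
  by_contra! h
  have hcov : I.IsSetCover (K.erase v) := by
    intro u
    obtain ⟨i, hi, hu⟩ := hK.1 u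
    by_cases hiv : i = v
    · obtain ⟨j, hj, huj, hjv⟩ := h u (hiv ▸ hu)
      exact ⟨j, Finset.mem_erase.2 ⟨hjv, hj⟩, huj⟩
    · exact ⟨i, Finset.mem_erase.2 ⟨hiv, hi⟩, hu⟩
  exact Finset.notMem_erase v K (hK.2 hcov (Finset.erase_subset v K) hv)

/-- Hit counts are what the machine stores, so this is the form of minimality that a leaf can test.
-/
theorem isMinimalSetCover_iff {K : Finset (Fin I.m)} :
    I.IsMinimalSetCover K ↔
      (∀ u, I.hitCount K u ≠ 0) ∧ ∀ v ∈ K, ∃ u ∈ I.sets v, I.hitCount K u = 1 := by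
  have hpos : ∀ u, I.hitCount K u ≠ 0 ↔ ∃ i ∈ K, u ∈ I.sets i := by
    intro u
    simp [hitCount, Finset.filter_eq_empty_iff]
  constructor
  · intro h
    refine ⟨fun u => (hpos u).2 (h.1 u), fun v hv => ?_⟩
    obtain ⟨u, hu, hpriv⟩ := h.exists_private hv
    refine ⟨u, hu, Finset.card_eq_one.2 ⟨v, ?_⟩⟩
    ext i
    simp only [Finset.mem_filter, Finset.mem_singleton]
    exact ⟨fun hi => hpriv i hi.1 hi.2, fun hi => hi ▸ ⟨hv, hu⟩⟩
  · rintro ⟨h₁, h₂⟩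
    refine ⟨fun u => (hpos u).1 (h₁ u), fun K' hK' hsub v hv => ?_⟩
    obtain ⟨u, hu, hcard⟩ := h₂ v hv
    obtain ⟨x, hx⟩ := Finset.card_eq_one.1 hcard
    obtain ⟨i, hi, hui⟩ := hK' u
    have hix : i = x := Finset.mem_singleton.1 (hx ▸ Finset.mem_filter.2 ⟨hsub hi, hui⟩)
    have hvx : v = x := Finset.mem_singleton.1 (hx ▸ Finset.mem_filter.2 ⟨hv, hu⟩)
    rw [hvx, ← hix]
    exact hi

/-- Some branch always agrees with `K` on `D`. The two automatic decisions agree as well: a private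
element of `v ∈ K` is not covered by `C`, so a set covering nothing new is outside `K`; and in a
forced step `K` must cover the critical element from outside `D`, which only `v` can do. -/
theorem GreedyTree.mem_of_isMinimalSetCover {D C : Finset (Fin I.m)}
    {L : List (Finset (Fin I.m))} (h : I.GreedyTree D C L) {K : Finset (Fin I.m)}
    (hK : I.IsMinimalSetCover K) (hC : K ∩ D = C) : K ∈ L := by
  induction h with
  | leaf => simp [← hC]
  | @skip D C v L hv h0 _ ih =>
    apply ih
    rw [Finset.inter_insert_of_notMem, hC]
    intro hvK
    obtain ⟨u, hu, hpriv⟩ := hK.exists_private hvK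
    have hmem : u ∈ I.newly C v := by
      refine Finset.mem_filter.2 ⟨hu, fun i hi hui => ?_⟩
      rw [← hC, Finset.mem_inter] at hi
      exact hv.1 (hpriv i hi.1 hui ▸ hi.2)
    rw [Finset.card_eq_zero.1 h0] at hmem
    simp at hmem
  | @take D C v L hv hf _ ih =>
    apply ih
    rw [Finset.inter_insert_of_mem, hC]
    obtain ⟨u, hu, hcard⟩ := hf
    obtain ⟨hu, hunc⟩ := Finset.mem_filter.1 hu
    obtain ⟨x, hx⟩ := Finset.card_eq_one.1 hcard
    obtain ⟨i, hi, hui⟩ := hK.1 u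
    have hiD : i ∉ D := fun hiD => hunc i (hC ▸ Finset.mem_inter.2 ⟨hi, hiD⟩) hui
    have hix : i = x := Finset.mem_singleton.1
      (hx ▸ Finset.mem_filter.2 ⟨Finset.mem_compl.2 hiD, hui⟩)
    have hvx : v = x := Finset.mem_singleton.1
      (hx ▸ Finset.mem_filter.2 ⟨Finset.mem_compl.2 hv.1, hu⟩)
    rw [hvx, ← hix]
    exact hi
  | @branch D C v L₁ L₀ hv _ _ _ _ ih₁ ih₀ =>
    rw [List.mem_append]
    by_cases hvK : v ∈ K
    · exact Or.inl (ih₁ (by rw [Finset.inter_insert_of_mem hvK, hC]))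
    · exact Or.inr (ih₀ (by rw [Finset.inter_insert_of_notMem hvK, hC]))

/-! ### Counting the leaves -/

theorem card_compl_insert {D : Finset (Fin I.m)} {v : Fin I.m} (h : v ∉ D) :
    Dᶜ.card = (insert v D)ᶜ.card + 1 := by
  rw [Finset.compl_insert, Finset.card_erase_add_one (Finset.mem_compl.2 h)]

theorem options_insert (D : Finset (Fin I.m)) (v : Fin I.m) (u : Fin I.n) :
    I.options (insert v D) u = (I.options D u).erase v := by
  ext i
  simp only [options, Finset.mem_filter, Finset.mem_compl, Finset.mem_insert, Finset.mem_erase]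
  tauto

theorem active_insert_subset (D C : Finset (Fin I.m)) (v : Fin I.m) :
    I.active (insert v D) C ⊆ I.active D C := by
  intro u hu
  obtain ⟨_, hu, i, hi⟩ := Finset.mem_filter.1 hu
  rw [options_insert] at hi
  exact Finset.mem_filter.2 ⟨Finset.mem_univ _, hu, i, Finset.mem_of_mem_erase hi⟩

theorem newly_subset_active {D : Finset (Fin I.m)} (C : Finset (Fin I.m)) {v : Fin I.m}
    (hv : v ∉ D) : I.newly C v ⊆ I.active D C := by
  intro u hu
  obtain ⟨hu, hunc⟩ := Finset.mem_filter.1 hu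
  exact Finset.mem_filter.2 ⟨Finset.mem_univ _, hunc, v,
    Finset.mem_filter.2 ⟨Finset.mem_compl.2 hv, hu⟩⟩

/-- The elements newly covered by `v` were active and cease to be so; no element becomes active. -/
theorem card_active_take {D : Finset (Fin I.m)} (C : Finset (Fin I.m)) {v : Fin I.m}
    (hv : v ∉ D) :
    (I.active (insert v D) (insert v C)).card + (I.newly C v).card ≤ (I.active D C).card := by
  rw [← Finset.card_union_of_disjoint]
  · refine Finset.card_le_card (Finset.union_subset ?_ (newly_subset_active C hv))
    refine Finset.Subset.trans ?_ (active_insert_subset D C v)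
    intro u hu
    obtain ⟨_, hu, ho⟩ := Finset.mem_filter.1 hu
    exact Finset.mem_filter.2
      ⟨Finset.mem_univ _, fun i hi => hu i (Finset.mem_insert_of_mem hi), ho⟩
  · rw [Finset.disjoint_left]
    intro u hu hn
    exact (Finset.mem_filter.1 hu).2.1 v (Finset.mem_insert_self _ _) (Finset.mem_filter.1 hn).1

theorem Forced.card_newly_ne_zero {D C : Finset (Fin I.m)} {v : Fin I.m}
    (h : I.Forced D C v) : (I.newly C v).card ≠ 0 := by
  obtain ⟨u, hu, _⟩ := h
  exact Finset.card_ne_zero_of_mem hu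

theorem GreedyTree.length_le_two_pow {D C : Finset (Fin I.m)}
    {L : List (Finset (Fin I.m))} (h : I.GreedyTree D C L) : L.length ≤ 2 ^ Dᶜ.card := by
  induction h with
  | leaf => simp
  | skip hv _ _ ih | take hv _ _ ih =>
    rw [card_compl_insert hv.1, pow_succ]
    omega
  | branch hv _ _ _ _ ih₁ ih₀ =>
    rw [card_compl_insert hv.1, pow_succ, List.length_append]
    omega

/-- Every taken set covers a new element. -/
theorem GreedyTree.length_le_of_active {D C : Finset (Fin I.m)}
    {L : List (Finset (Fin I.m))} (h : I.GreedyTree D C L) :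
    (L.length : ℝ) ≤ (3 / 2) ^ Dᶜ.card * 2 ^ (I.active D C).card := by
  have key : ∀ {D C : Finset (Fin I.m)} {v : Fin I.m}, v ∉ D → (I.newly C v).card ≠ 0 →
      (2 : ℝ) ^ (I.active (insert v D) (insert v C)).card * 2 ≤ 2 ^ (I.active D C).card := by
    intro D C v hv h0
    rw [← pow_succ]
    have := card_active_take C hv
    exact pow_le_pow_right₀ one_le_two (by omega)
  have key0 : ∀ {D C : Finset (Fin I.m)} {v : Fin I.m},
      (2 : ℝ) ^ (I.active (insert v D) C).card ≤ 2 ^ (I.active D C).card := fun {D C v} =>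
    pow_le_pow_right₀ one_le_two (Finset.card_le_card (active_insert_subset D C v))
  induction h with
  | leaf => simpa using one_le_pow₀ (one_le_two (α := ℝ))
  | @skip D C v L hv h0 _ ih =>
    rw [card_compl_insert hv.1, pow_succ]
    have h1 : (0 : ℝ) < (3 / 2) ^ (insert v D)ᶜ.card := by positivity
    have h2 := mul_le_mul_of_nonneg_left (key0 (D := D) (C := C) (v := v)) h1.le
    have h3 : (0 : ℝ) < (3 / 2) ^ (insert v D)ᶜ.card * 2 ^ (I.active D C).card := by positivity
    linarith
  | @take D C v L hv hf _ ih =>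
    rw [card_compl_insert hv.1, pow_succ]
    have h1 : (0 : ℝ) < (3 / 2) ^ (insert v D)ᶜ.card := by positivity
    have h2 := mul_le_mul_of_nonneg_left (key hv.1 hf.card_newly_ne_zero) h1.le
    have h3 : (0 : ℝ) < (3 / 2) ^ (insert v D)ᶜ.card * 2 ^ (I.active D C).card := by positivity
    linarith
  -- With k undecided sets left and a active elements, the two children contribute (3/2)^k ·
  -- (2^(a−1) + 2^a) = (3/2)^(k+1) · 2^a.
  | @branch D C v L₁ L₀ hv h0 _ _ _ ih₁ ih₀ =>
    rw [card_compl_insert hv.1, pow_succ, List.length_append, Nat.cast_add]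
    have h1 : (0 : ℝ) < (3 / 2) ^ (insert v D)ᶜ.card := by positivity
    have h2 := mul_le_mul_of_nonneg_left (key hv.1 h0) h1.le
    have h3 := mul_le_mul_of_nonneg_left (key0 (D := D) (C := C) (v := v)) h1.le
    linarith

/-- As long as some undecided set covers at least `d` new elements, few sets are taken. -/
theorem GreedyTree.length_le_of_low {d m₀ : ℕ} (hd : 1 ≤ d) {g : ℝ} (hg : 0 ≤ g)
    (low : ∀ D C L, I.GreedyTree D C L → (∀ w, w ∉ D → (I.newly C w).card ≤ d) →
      m₀ ≤ Dᶜ.card → (L.length : ℝ) ≤ 2 ^ Dᶜ.card * g)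
    {D C : Finset (Fin I.m)} {L : List (Finset (Fin I.m))} (h : I.GreedyTree D C L)
    (hm : m₀ ≤ Dᶜ.card) :
    (L.length : ℝ) ≤ 2 ^ Dᶜ.card *
      ((3 / 4) ^ (Dᶜ.card - m₀) * 2 ^ ((I.active D C).card / d : ℝ) + g) := by
  by_cases hlow : ∀ w, w ∉ D → (I.newly C w).card ≤ d
  · refine (low D C L h hlow hm).trans ?_
    have : (0 : ℝ) ≤ (3 / 4) ^ (Dᶜ.card - m₀) * 2 ^ ((I.active D C).card / d : ℝ) := by positivity
    gcongr
    linarith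
  have hone : (1 : ℝ) ≤ 2 ^ ((I.active D C).card / d : ℝ) :=
    Real.one_le_rpow one_le_two (by positivity)
  -- At the threshold `m₀` the power of 3/4 is 1, and the trivial bound by exhaustive search
  -- suffices.
  rcases hm.eq_or_lt with hm' | hm'
  · have h2 : (L.length : ℝ) ≤ 2 ^ Dᶜ.card := by exact_mod_cast h.length_le_two_pow
    refine h2.trans (le_mul_of_one_le_right (by positivity) ?_)
    rw [← hm', Nat.sub_self, pow_zero, one_mul]
    linarith
  push Not at hlow
  obtain ⟨w, hw, hdw⟩ := hlow
  have hd0 : (0 : ℝ) < d := by exact_mod_cast hd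
  -- The greedy choice covers at least as much as `w`, so taking it removes at least `d` active
  -- elements and halves the potential 2^(active/d).
  have key : ∀ v, I.IsGreedyChoice D C v →
      (2 : ℝ) ^ ((I.active (insert v D) (insert v C)).card / d : ℝ) * 2 ≤
        2 ^ ((I.active D C).card / d : ℝ) := by
    intro v hv
    have h1 := card_active_take C hv.1
    have h2 := hv.2 w hw
    have h3 : ((I.active (insert v D) (insert v C)).card : ℝ) + d ≤ (I.active D C).card := by
      exact_mod_cast (by omega :
        (I.active (insert v D) (insert v C)).card + d ≤ (I.active D C).card)
    have h4 : (2 : ℝ) ^ ((I.active (insert v D) (insert v C)).card / d : ℝ) * 2 =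
        2 ^ ((I.active (insert v D) (insert v C)).card / d + 1 : ℝ) := by
      rw [Real.rpow_add two_pos, Real.rpow_one]
    rw [h4]
    apply Real.rpow_le_rpow_of_exponent_le one_le_two
    rw [div_add_one hd0.ne']
    gcongr
  have key0 : ∀ v, (2 : ℝ) ^ ((I.active (insert v D) C).card / d : ℝ) ≤
      2 ^ ((I.active D C).card / d : ℝ) := by
    intro v
    apply Real.rpow_le_rpow_of_exponent_le one_le_two
    have := Finset.card_le_card (active_insert_subset D C v)
    gcongr
  have hpow : ∀ v, v ∉ D → (2 : ℝ) ^ Dᶜ.card = 2 ^ (insert v D)ᶜ.card * 2 ∧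
      (3 / 4 : ℝ) ^ (Dᶜ.card - m₀) = (3 / 4) ^ ((insert v D)ᶜ.card - m₀) * (3 / 4) ∧
      m₀ ≤ (insert v D)ᶜ.card := by
    intro v hv
    have h1 := card_compl_insert hv
    refine ⟨by rw [h1, pow_succ], ?_, by omega⟩
    rw [← pow_succ]
    congr 1
    omega
  cases h with
  | leaf => simp at hw
  | @skip _ _ v _ hv h0 hL =>
    have := hv.2 w hw
    omega
  | @take _ _ v _ hv hf hL =>
    obtain ⟨e₁, e₂, e₃⟩ := hpow v hv.1
    have ih := hL.length_le_of_low hd hg low e₃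
    have hk := key v hv
    rw [e₁, e₂, mul_assoc]
    refine ih.trans (mul_le_mul_of_nonneg_left ?_ (by positivity))
    have h1 : (0 : ℝ) ≤ (3 / 4) ^ ((insert v D)ᶜ.card - m₀) := by positivity
    have h2 := mul_le_mul_of_nonneg_left hk h1
    have h3 : (0 : ℝ) ≤ (3 / 4) ^ ((insert v D)ᶜ.card - m₀) *
      2 ^ ((I.active D C).card / d : ℝ) := by positivity
    linarith
  -- The children weigh 1/2 + 1 = 3/2 = 2 · (3/4): one factor 2 goes to 2^|Dᶜ|, and 3/4 is the gain
  -- of this step.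
  | @branch _ _ v L₁ L₀ hv _ _ hL₁ hL₀ =>
    obtain ⟨e₁, e₂, e₃⟩ := hpow v hv.1
    have ih₁ := hL₁.length_le_of_low hd hg low e₃
    have ih₀ := hL₀.length_le_of_low hd hg low e₃
    rw [e₁, e₂, mul_assoc, List.length_append, Nat.cast_add]
    refine (add_le_add ih₁ ih₀).trans ?_
    rw [← mul_add]
    refine mul_le_mul_of_nonneg_left ?_ (by positivity)
    have h1 : (0 : ℝ) ≤ (3 / 4) ^ ((insert v D)ᶜ.card - m₀) := by positivity
    have h2 := mul_le_mul_of_nonneg_left (key v hv) h1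
    have h3 := mul_le_mul_of_nonneg_left (key0 v) h1
    linarith
termination_by Dᶜ.card
decreasing_by
  all_goals
    have := card_compl_insert hv.1
    omega

/-- The leaves hit the options of pairwise disjoint active elements. -/
theorem GreedyTree.length_le_of_disjoint {D C : Finset (Fin I.m)}
    {L : List (Finset (Fin I.m))} (h : I.GreedyTree D C L) (E : Finset (Fin I.n))
    (hE : E ⊆ I.active D C)
    (hdis : (E : Set (Fin I.n)).PairwiseDisjoint (I.options D)) :
    (L.length : ℝ) ≤ 2 ^ Dᶜ.card * ∏ u ∈ E, (1 - (1 / 2) ^ (I.options D u).card) := by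
  -- The right-hand side counts the families of undecided sets that meet the options of every `u ∈
  -- E`; disjointness turns this count into a product. By disjointness the chosen set belongs to the
  -- options of at most one `u₀ ∈ E`. Taking it deletes `u₀` from `E`; discarding it shrinks only
  -- the options of `u₀`.
  have hopt : ∀ {D : Finset (Fin I.m)} {v : Fin I.m} {u : Fin I.n}, v ∉ I.options D u →
      I.options (insert v D) u = I.options D u := fun {D v u} hvu => by
    rw [options_insert, Finset.erase_eq_of_notMem hvu]
  have hact : ∀ {D C : Finset (Fin I.m)} {v : Fin I.m} {u : Fin I.n}, u ∈ I.active D C →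
      v ∉ I.options D u → v ∉ D → u ∈ I.active (insert v D) (insert v C) := by
    intro D C v u hu hvu hv
    obtain ⟨_, hu, ho⟩ := Finset.mem_filter.1 hu
    refine Finset.mem_filter.2 ⟨Finset.mem_univ _, fun i hi => ?_, by rwa [hopt hvu]⟩
    rcases Finset.mem_insert.1 hi with rfl | hi
    · exact fun hui => hvu (Finset.mem_filter.2 ⟨Finset.mem_compl.2 hv, hui⟩)
    · exact hu i hi
  have hact0 : ∀ {D C : Finset (Fin I.m)} {v : Fin I.m} {u : Fin I.n}, u ∈ I.active D C →
      ((I.options D u).erase v).Nonempty → u ∈ I.active (insert v D) C := by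
    intro D C v u hu ho
    exact Finset.mem_filter.2 ⟨Finset.mem_univ _, (Finset.mem_filter.1 hu).2.1,
      by rwa [options_insert]⟩
  have hact1 : ∀ {D C : Finset (Fin I.m)} {v : Fin I.m} {u : Fin I.n}, u ∈ I.active D C →
      v ∉ I.options D u → u ∈ I.active (insert v D) C := by
    intro D C v u hu hvu
    refine hact0 hu ?_
    rw [Finset.erase_eq_of_notMem hvu]
    exact (Finset.mem_filter.1 hu).2.2
  have hdis' : ∀ {D : Finset (Fin I.m)} {v : Fin I.m} {E : Finset (Fin I.n)},
      (E : Set (Fin I.n)).PairwiseDisjoint (I.options D) →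
      (E : Set (Fin I.n)).PairwiseDisjoint (I.options (insert v D)) := by
    intro D v E hE
    refine hE.mono_on fun u _ => ?_
    rw [options_insert]
    exact Finset.erase_subset _ _
  have hprod : ∀ {D : Finset (Fin I.m)} {v : Fin I.m} {E : Finset (Fin I.n)},
      (∀ u ∈ E, v ∉ I.options D u) →
      ∏ u ∈ E, (1 - (1 / 2 : ℝ) ^ (I.options (insert v D) u).card) =
        ∏ u ∈ E, (1 - (1 / 2 : ℝ) ^ (I.options D u).card) := fun {D v E} hE =>
    Finset.prod_congr rfl fun u hu => by rw [hopt (hE u hu)]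
  have hnonneg : ∀ (D : Finset (Fin I.m)) (E : Finset (Fin I.n)),
      0 ≤ ∏ u ∈ E, (1 - (1 / 2 : ℝ) ^ (I.options D u).card) := fun D E =>
    Finset.prod_nonneg fun u _ => sub_nonneg.2 (pow_le_one₀ (by norm_num) (by norm_num))
  have hsplit : ∀ {D : Finset (Fin I.m)} {v : Fin I.m} {E : Finset (Fin I.n)} {u₀ : Fin I.n},
      (E : Set (Fin I.n)).PairwiseDisjoint (I.options D) → u₀ ∈ E → v ∈ I.options D u₀ →
      ∀ u ∈ E.erase u₀, v ∉ I.options D u := by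
    intro D v E u₀ hE hu₀ hv u hu hvu
    obtain ⟨hne, hu⟩ := Finset.mem_erase.1 hu
    exact Finset.disjoint_left.1 (hE hu hu₀ hne) hvu hv
  have hhalf : ∀ {D : Finset (Fin I.m)} {v : Fin I.m} {u : Fin I.n}, v ∈ I.options D u →
      (1 / 2 : ℝ) ^ (I.options (insert v D) u).card = 2 * (1 / 2) ^ (I.options D u).card := by
    intro D v u hv
    rw [options_insert, ← Finset.card_erase_add_one hv, pow_succ]
    ring
  induction h generalizing E with
  | leaf =>
    have : E = ∅ := by
      rw [Finset.eq_empty_iff_forall_notMem]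
      intro u hu
      obtain ⟨i, hi⟩ := (Finset.mem_filter.1 (hE hu)).2.2
      simp [options] at hi
    simp [this]
  | @skip D C v L hv h0 _ ih =>
    have hno : ∀ u ∈ E, v ∉ I.options D u := by
      intro u hu hvu
      have : u ∈ I.newly C v := Finset.mem_filter.2
        ⟨(Finset.mem_filter.1 hvu).2, (Finset.mem_filter.1 (hE hu)).2.1⟩
      rw [Finset.card_eq_zero.1 h0] at this
      simp at this
    have ih := ih E (fun u hu => hact1 (hE hu) (hno u hu)) (hdis' hdis)
    rw [hprod hno] at ih
    rw [card_compl_insert hv.1, pow_succ]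
    have := mul_nonneg (pow_nonneg (zero_le_two (α := ℝ)) (insert v D)ᶜ.card) (hnonneg D E)
    linarith
  | @take D C v L hv hf _ ih =>
    rw [card_compl_insert hv.1, pow_succ]
    by_cases hex : ∃ u₀ ∈ E, v ∈ I.options D u₀
    · obtain ⟨u₀, hu₀, hvu₀⟩ := hex
      have hno := hsplit hdis hu₀ hvu₀
      have ih := ih (E.erase u₀)
        (fun u hu => hact (hE (Finset.mem_of_mem_erase hu)) (hno u hu) hv.1)
        (hdis' (hdis.subset (Finset.coe_subset.2 (Finset.erase_subset _ _))))
      rw [hprod hno] at ih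
      rw [← Finset.mul_prod_erase E _ hu₀]
      -- The factor of `u₀` is at least 1/2, which pays for its removal because only one child
      -- remains.
      have hle : (1 / 2 : ℝ) ^ (I.options D u₀).card ≤ 1 / 2 :=
        pow_le_of_le_one (by norm_num) (by norm_num) (Finset.card_ne_zero_of_mem hvu₀)
      have h0 := mul_nonneg (pow_nonneg (zero_le_two (α := ℝ)) (insert v D)ᶜ.card)
        (hnonneg D (E.erase u₀))
      have := mul_le_mul_of_nonneg_left hle h0
      linarith
    · push Not at hex
      have ih := ih E (fun u hu => hact (hE hu) (hex u hu) hv.1) (hdis' hdis)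
      rw [hprod hex] at ih
      have := mul_nonneg (pow_nonneg (zero_le_two (α := ℝ)) (insert v D)ᶜ.card) (hnonneg D E)
      linarith
  | @branch D C v L₁ L₀ hv _ hf _ _ ih₁ ih₀ =>
    rw [card_compl_insert hv.1, pow_succ, List.length_append, Nat.cast_add]
    by_cases hex : ∃ u₀ ∈ E, v ∈ I.options D u₀
    · obtain ⟨u₀, hu₀, hvu₀⟩ := hex
      have hno := hsplit hdis hu₀ hvu₀
      have ih₁ := ih₁ (E.erase u₀)
        (fun u hu => hact (hE (Finset.mem_of_mem_erase hu)) (hno u hu) hv.1)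
        (hdis' (hdis.subset (Finset.coe_subset.2 (Finset.erase_subset _ _))))
      have ih₀ := ih₀ E (fun u hu => by
        by_cases h : u = u₀
        · subst h
          refine hact0 (hE hu) ?_
          rw [Finset.nonempty_iff_ne_empty]
          intro hempty
          -- If discarding `v` emptied the options of `u`, then `v` would have been forced; hence
          -- `u` stays active.
          refine hf ⟨u, Finset.mem_filter.2
            ⟨(Finset.mem_filter.1 hvu₀).2, (Finset.mem_filter.1 (hE hu)).2.1⟩, ?_⟩
          rw [← Finset.card_erase_add_one hvu₀, hempty, Finset.card_empty]
        · exact hact1 (hE hu) (hno u (Finset.mem_erase.2 ⟨h, hu⟩))) (hdis' hdis)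
      -- With x = 2^(−|options of `u₀`|), the factors of the children are 1 and 1 − 2x, whose sum is
      -- 2(1 − x).
      rw [hprod hno] at ih₁
      rw [← Finset.mul_prod_erase E _ hu₀, hprod hno, hhalf hvu₀] at ih₀
      rw [← Finset.mul_prod_erase E _ hu₀]
      linarith
    · push Not at hex
      have ih₁ := ih₁ E (fun u hu => hact (hE hu) (hex u hu) hv.1) (hdis' hdis)
      have ih₀ := ih₀ E (fun u hu => hact1 (hE hu) (hex u hu)) (hdis' hdis)
      rw [hprod hex] at ih₁ ih₀
      linarith

/-! ### Low degrees -/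

/-- For a maximal disjoint subfamily `E`, each `f u` meets some `f e` with `e ∈ E`. The union of
these `f e` has at most |E|·k points, and each point lies in `f u` for at most `d` elements `u`. -/
theorem exists_disjoint_subfamily {α β : Type*} [DecidableEq α] [DecidableEq β]
    (S : Finset α) (f : α → Finset β) (k d : ℕ) (hne : ∀ u ∈ S, (f u).Nonempty)
    (hk : ∀ u ∈ S, (f u).card ≤ k) (hd : ∀ b, (S.filter fun u => b ∈ f u).card ≤ d) :
    ∃ E ⊆ S, (E : Set α).PairwiseDisjoint f ∧ S.card ≤ E.card * k * d := by
  classical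
  obtain ⟨E, hE⟩ := (S.powerset.filter fun E : Finset α => (E : Set α).PairwiseDisjoint f).exists_maximal
    ⟨∅, by simp⟩
  obtain ⟨hE₁, hdis⟩ := Finset.mem_filter.1 hE.1
  have hES := Finset.mem_powerset.1 hE₁
  refine ⟨E, hES, hdis, ?_⟩
  have hcover : S ⊆ (E.biUnion f).biUnion fun b => S.filter fun u => b ∈ f u := by
    intro u hu
    by_contra hcon
    simp only [Finset.mem_biUnion, Finset.mem_filter, not_exists, not_and] at hcon
    have hd' : ∀ e ∈ E, Disjoint (f u) (f e) := fun e he =>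
      Finset.disjoint_left.2 fun b hb hbe => hcon b ⟨e, he, hbe⟩ hu hb
    have huE : u ∉ E := fun huE => by
      have := hd' u huE
      rw [disjoint_self, Finset.bot_eq_empty] at this
      exact (hne u hu).ne_empty this
    refine huE (hE.2 (y := insert u E) ?_ (Finset.subset_insert _ _) (Finset.mem_insert_self _ _))
    refine Finset.mem_filter.2 ⟨Finset.mem_powerset.2 (Finset.insert_subset hu hES), ?_⟩
    rw [Finset.coe_insert]
    exact hdis.insert fun e he _ => hd' e he
  calc S.card ≤ _ := Finset.card_le_card hcover
    _ ≤ (E.biUnion f).card * d := Finset.card_biUnion_le_card_mul _ _ _ fun b _ => hd b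
    _ ≤ E.card * k * d := Nat.mul_le_mul_right _
        (Finset.card_biUnion_le_card_mul _ _ _ fun u hu => hk u (hES hu))

/-- Double counting of the incidences between active elements and undecided sets. -/
theorem sum_card_options_active (D C : Finset (Fin I.m)) :
    ∑ u ∈ I.active D C, (I.options D u).card = ∑ w ∈ Dᶜ, (I.newly C w).card := by
  calc ∑ u ∈ I.active D C, (I.options D u).card
      = ∑ w ∈ Dᶜ, ((I.active D C).filter fun u => u ∈ I.sets w).card :=
        Finset.sum_card_bipartiteAbove_eq_sum_card_bipartiteBelow (fun u w => u ∈ I.sets w)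
    _ = ∑ w ∈ Dᶜ, (I.newly C w).card := Finset.sum_congr rfl fun w hw => by
        congr 1
        ext u
        refine ⟨fun hu => ?_, fun hu => ?_⟩
        · obtain ⟨hu, huw⟩ := Finset.mem_filter.1 hu
          exact Finset.mem_filter.2 ⟨huw, (Finset.mem_filter.1 hu).2.1⟩
        · exact Finset.mem_filter.2
            ⟨newly_subset_active C (Finset.mem_compl.1 hw) hu, (Finset.mem_filter.1 hu).1⟩

/-- There are at most |Dᶜ|·d incidences, so at most |Dᶜ|/8 active elements have more than 8d
options. More than |Dᶜ|/4 elements are active, so more than |Dᶜ|/8 remain, and passing to a disjoint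
subfamily costs a factor 8d·d. -/
theorem exists_disjoint_active {d : ℕ} (hd : 1 ≤ d) {D C : Finset (Fin I.m)}
    (hlow : ∀ w, w ∉ D → (I.newly C w).card ≤ d) (hbig : Dᶜ.card < 4 * (I.active D C).card) :
    ∃ E ⊆ I.active D C, (E : Set (Fin I.n)).PairwiseDisjoint (I.options D) ∧
      (∀ u ∈ E, (I.options D u).card ≤ 8 * d) ∧ Dᶜ.card ≤ E.card * (64 * d * d) := by
  have hsum : ∑ u ∈ I.active D C, (I.options D u).card ≤ Dᶜ.card * d := by
    rw [sum_card_options_active]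
    exact Finset.sum_le_card_nsmul _ _ _ fun w hw => hlow w (Finset.mem_compl.1 hw)
  set S := (I.active D C).filter fun u => (I.options D u).card ≤ 8 * d with hS
  have hlarge : ((I.active D C).filter fun u => ¬ (I.options D u).card ≤ 8 * d).card * (8 * d) ≤
      Dᶜ.card * d := by
    refine le_trans ?_ hsum
    refine le_trans ?_ (Finset.sum_le_sum_of_subset (Finset.filter_subset
      (fun u => ¬ (I.options D u).card ≤ 8 * d) _))
    exact Finset.card_nsmul_le_sum _ _ _ fun u hu => (not_le.1 (Finset.mem_filter.1 hu).2).le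
  have hadd : S.card + ((I.active D C).filter fun u => ¬ (I.options D u).card ≤ 8 * d).card =
      (I.active D C).card := Finset.card_filter_add_card_filter_not _
  rw [← mul_assoc] at hlarge
  have hlarge := Nat.le_of_mul_le_mul_right hlarge hd
  obtain ⟨E, hES, hdis, hcard⟩ := exists_disjoint_subfamily S (I.options D) (8 * d) d
    (fun u hu => (Finset.mem_filter.1 (Finset.mem_filter.1 hu).1).2.2)
    (fun u hu => (Finset.mem_filter.1 hu).2) (by
      intro b
      by_cases hb : b ∈ D
      · rw [Finset.filter_false_of_mem, Finset.card_empty]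
        · exact Nat.zero_le _
        · intro u _ hbu
          exact Finset.mem_compl.1 (Finset.mem_filter.1 hbu).1 hb
      · refine (Finset.card_le_card fun u hu => ?_).trans (hlow b hb)
        obtain ⟨hu, hbu⟩ := Finset.mem_filter.1 hu
        exact Finset.mem_filter.2 ⟨(Finset.mem_filter.1 hbu).2,
          (Finset.mem_filter.1 (Finset.mem_filter.1 hu).1).2.1⟩)
  refine ⟨E, hES.trans (Finset.filter_subset _ _), hdis,
    fun u hu => (Finset.mem_filter.1 (hES hu)).2, ?_⟩
  have : E.card * (64 * d * d) = 8 * (E.card * (8 * d) * d) := by ring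
  omega

/-- With bounded degrees the greedy procedure is exponentially faster than exhaustive search. -/
theorem exists_length_le_of_degree_le {d : ℕ} (hd : 1 ≤ d) :
    ∃ δ : ℝ, 0 < δ ∧ δ < 1 ∧ ∀ (I : SetSystem) (D C : Finset (Fin I.m))
      (L : List (Finset (Fin I.m))), I.GreedyTree D C L →
      (∀ w, w ∉ D → (I.newly C w).card ≤ d) → (L.length : ℝ) ≤ 2 ^ Dᶜ.card * δ ^ Dᶜ.card := by
  -- `a` serves the case of at most |Dᶜ|/4 active elements, where (3/2)^k · 2^(k/4) = 2^k · a^k. `b`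
  -- bounds the factor of one element with at most 8d options, and at least k/(64d²) disjoint ones
  -- give the rate `c` per set.
  set a : ℝ := 3 / 4 * 2 ^ (1 / 4 : ℝ) with ha
  set b : ℝ := 1 - (1 / 2) ^ (8 * d) with hb
  have hd0 : (0 : ℝ) < d := by exact_mod_cast hd
  have ha0 : 0 < a := by positivity
  have ha1 : a < 1 := by
    have : (2 : ℝ) ^ (1 / 4 : ℝ) < 4 / 3 := by
      refine lt_of_pow_lt_pow_left₀ 4 (by norm_num) ?_
      rw [← Real.rpow_mul_natCast zero_le_two]
      norm_num
    rw [ha]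
    linarith
  have hb0 : 0 < b := sub_pos.2 (pow_lt_one₀ (by norm_num) (by norm_num) (by omega))
  have hb1 : b < 1 := sub_lt_self _ (by positivity)
  set c : ℝ := b ^ (1 / (64 * d * d) : ℝ) with hc
  have hc0 : 0 < c := by positivity
  have hc1 : c < 1 := Real.rpow_lt_one hb0.le hb1 (by positivity)
  refine ⟨max a c, lt_max_of_lt_left ha0, max_lt ha1 hc1, fun I D C L h hlow => ?_⟩
  by_cases hbig : Dᶜ.card < 4 * (I.active D C).card
  · obtain ⟨E, hE, hdis, hk, hcard⟩ := exists_disjoint_active hd hlow hbig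
    refine (h.length_le_of_disjoint E hE hdis).trans ?_
    refine mul_le_mul_of_nonneg_left ?_ (by positivity)
    have h1 : ∏ u ∈ E, (1 - (1 / 2 : ℝ) ^ (I.options D u).card) ≤ b ^ E.card := by
      rw [← Finset.prod_const]
      refine Finset.prod_le_prod (fun u _ => sub_nonneg.2 (pow_le_one₀ (by norm_num) (by norm_num)))
        fun u hu => sub_le_sub_left ?_ _
      exact pow_le_pow_of_le_one (by norm_num) (by norm_num) (hk u hu)
    have h2 : b ^ E.card ≤ c ^ Dᶜ.card := by
      rw [hc, ← Real.rpow_natCast, ← Real.rpow_natCast, ← Real.rpow_mul hb0.le]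
      refine Real.rpow_le_rpow_of_exponent_ge hb0 hb1.le ?_
      rw [one_div_mul_eq_div, div_le_iff₀ (by positivity)]
      exact_mod_cast hcard
    exact (h1.trans h2).trans (pow_le_pow_left₀ hc0.le (le_max_right _ _) _)
  · push Not at hbig
    refine h.length_le_of_active.trans ?_
    have h1 : (2 : ℝ) ^ (I.active D C).card ≤ (2 ^ (1 / 4 : ℝ)) ^ Dᶜ.card := by
      rw [← Real.rpow_natCast, ← Real.rpow_natCast, ← Real.rpow_mul zero_le_two]
      refine Real.rpow_le_rpow_of_exponent_le one_le_two ?_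
      have : (4 * (I.active D C).card : ℝ) ≤ Dᶜ.card := by exact_mod_cast hbig
      linarith
    calc (3 / 2 : ℝ) ^ Dᶜ.card * 2 ^ (I.active D C).card
        ≤ (3 / 2) ^ Dᶜ.card * (2 ^ (1 / 4 : ℝ)) ^ Dᶜ.card := by gcongr
      _ = 2 ^ Dᶜ.card * a ^ Dᶜ.card := by
        rw [← mul_pow, ← mul_pow, ha]
        ring_nf
      _ ≤ 2 ^ Dᶜ.card * max a c ^ Dᶜ.card := by
        gcongr
        exact le_max_left _ _

/-- The number of leaves of the greedy procedure on set systems of bounded density. -/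
theorem exists_length_le_of_density {r : ℝ} (hr : 0 < r) :
    ∃ ε : ℝ, 0 < ε ∧ ∀ (I : SetSystem) (L : List (Finset (Fin I.m))),
      I.GreedyTree ∅ ∅ L → (I.n : ℝ) ≤ r * I.m →
      (L.length : ℝ) ≤ 3 * 2 ^ ((1 - ε) * (I.m : ℝ)) := by
  -- With this threshold the potential 2^(n/d) is at most 2^(m/20), less than the gain (3/4)^(m/2)
  -- of the high-degree phase.
  set d := ⌈20 * r⌉₊ with hd
  have hd1 : 1 ≤ d := Nat.ceil_pos.2 (by positivity)
  have hd0 : (0 : ℝ) < d := by exact_mod_cast hd1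
  obtain ⟨δ, hδ0, hδ1, hδ⟩ := exists_length_le_of_degree_le hd1
  set a : ℝ := (3 / 4) ^ (1 / 2 : ℝ) * 2 ^ (1 / 20 : ℝ) with ha
  set b : ℝ := δ ^ (1 / 2 : ℝ) with hb
  have ha0 : 0 < a := by positivity
  have hb0 : 0 < b := by positivity
  have ha1 : a < 1 := by
    refine lt_of_pow_lt_pow_left₀ 20 zero_le_one ?_
    rw [ha, mul_pow, ← Real.rpow_mul_natCast zero_le_two,
      ← Real.rpow_mul_natCast (by norm_num : (0 : ℝ) ≤ 3 / 4), Nat.cast_ofNat,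
      show (1 / 2 * 20 : ℝ) = (10 : ℕ) by norm_num, Real.rpow_natCast]
    norm_num
  have hb1 : b < 1 := Real.rpow_lt_one hδ0.le hδ1 (by norm_num)
  have hθ0 : 0 < max a b := lt_max_of_lt_left ha0
  have hθ1 : max a b < 1 := max_lt ha1 hb1
  refine ⟨-Real.logb 2 (max a b), neg_pos.2 (Real.logb_neg one_lt_two hθ0 hθ1),
    fun I L h hn => ?_⟩
  have hpow : (2 : ℝ) ^ ((1 - -Real.logb 2 (max a b)) * (I.m : ℝ)) = 2 ^ I.m * max a b ^ I.m := by
    rw [Real.rpow_mul zero_le_two, sub_neg_eq_add, Real.rpow_add two_pos, Real.rpow_one,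
      Real.rpow_logb two_pos (by norm_num) hθ0, Real.rpow_natCast, mul_pow]
  rw [hpow]
  have hμ : (∅ : Finset (Fin I.m))ᶜ.card = I.m := by simp
  -- The high-degree phase is cut off when ⌈m/2⌉ sets are undecided: either it has gained 3/4 in
  -- ⌊m/2⌋ rounds, or at least ⌈m/2⌉ sets remain for the low-degree bound.
  have hlen := h.length_le_of_low (m₀ := I.m - I.m / 2) hd1 (g := δ ^ (I.m - I.m / 2))
    (by positivity) (fun D C L h hlow hm => (hδ I D C L h hlow).trans (by
      gcongr 2 ^ _ * ?_
      exact pow_le_pow_of_le_one hδ0.le hδ1.le hm)) (by rw [hμ]; omega)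
  rw [hμ] at hlen
  have h1 : (3 / 4 : ℝ) ^ (I.m - (I.m - I.m / 2)) ≤ 2 * ((3 / 4) ^ (1 / 2 : ℝ)) ^ I.m := by
    have hsq : ((3 / 4 : ℝ) ^ (1 / 2 : ℝ)) ^ 2 = 3 / 4 := by
      rw [← Real.rpow_mul_natCast (by norm_num)]
      norm_num
    refine (pow_le_pow_iff_left₀ (by positivity) (by positivity) two_ne_zero).1 ?_
    rw [mul_pow, ← pow_mul, ← pow_mul, mul_comm I.m 2, pow_mul _ 2 I.m, hsq]
    -- The exponent is 2⌊m/2⌋ + 1 ≥ m; the factor 2 in the claim absorbs this rounding.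
    have h0 : (3 / 4 : ℝ) ^ ((I.m - (I.m - I.m / 2)) * 2 + 1) ≤ (3 / 4) ^ I.m :=
      pow_le_pow_of_le_one (by norm_num) (by norm_num) (by omega)
    rw [pow_succ] at h0
    have h1 : (0 : ℝ) < (3 / 4) ^ I.m := by positivity
    linarith
  have h2 : (2 : ℝ) ^ ((I.active ∅ ∅).card / d : ℝ) ≤ (2 ^ (1 / 20 : ℝ)) ^ I.m := by
    rw [← Real.rpow_natCast, ← Real.rpow_mul zero_le_two]
    refine Real.rpow_le_rpow_of_exponent_le one_le_two ?_
    rw [div_le_iff₀ hd0]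
    have h3 : ((I.active ∅ ∅).card : ℝ) ≤ I.n := by
      exact_mod_cast (Finset.card_le_univ _).trans_eq (Fintype.card_fin _)
    have h4 : 20 * r ≤ d := Nat.le_ceil _
    have h5 := mul_le_mul_of_nonneg_right h4 (Nat.cast_nonneg (α := ℝ) I.m)
    linarith
  have h3 : δ ^ (I.m - I.m / 2) ≤ b ^ I.m := by
    rw [hb, ← Real.rpow_natCast, ← Real.rpow_natCast, ← Real.rpow_mul hδ0.le]
    refine Real.rpow_le_rpow_of_exponent_ge hδ0 hδ1.le ?_
    have : (I.m : ℝ) ≤ 2 * (I.m - I.m / 2 : ℕ) := by exact_mod_cast (by omega)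
    linarith
  have h4 : (3 / 4 : ℝ) ^ (I.m - (I.m - I.m / 2)) * 2 ^ ((I.active ∅ ∅).card / d : ℝ) ≤
      2 * max a b ^ I.m := by
    calc _ ≤ 2 * ((3 / 4) ^ (1 / 2 : ℝ)) ^ I.m * (2 ^ (1 / 20 : ℝ)) ^ I.m := by gcongr
      _ = 2 * a ^ I.m := by rw [mul_assoc, ← mul_pow]
      _ ≤ _ := by gcongr; exact le_max_left _ _
  have h5 : b ^ I.m ≤ max a b ^ I.m := by gcongr; exact le_max_right _ _
  refine hlen.trans ?_
  rw [show 3 * (2 ^ I.m * max a b ^ I.m) = (2 : ℝ) ^ I.m * (2 * max a b ^ I.m + max a b ^ I.m) by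
    ring]
  gcongr
  exact h3.trans h5

end SetSystem

namespace BranchingRAM

/-! ### Composition of search trees -/

/-- Replace every leaf of a search tree by a search tree that depends on its state. -/
def SearchTree.graft (f : State → SearchTree) : SearchTree → SearchTree
  | .leaf s => f s
  | .step t => .step (t.graft f)
  | .fork t u => .fork (t.graft f) (u.graft f)

theorem SearchTree.paths_graft (f : State → SearchTree) (t : SearchTree) :
    (t.graft f).paths = t.paths.flatMap fun w => (f w.2).paths.map fun w' => (w'.1 + w.1, w'.2) := by
  induction t with
  | leaf s => simp [graft, paths]
  | step t ih => simp [graft, paths, ih, List.map_flatMap, List.flatMap_map, Function.comp_def, Nat.add_assoc]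
  | fork t u iht ihu =>
    simp [graft, paths, iht, ihu, List.map_flatMap, List.flatMap_map, Function.comp_def, Nat.add_assoc]

/-- The continuation list is only consulted after `k` is exhausted, so running `k'` amounts to
replacing the leaves. -/
theorem Runs.graft {k k' : List Prog} {s : State} {t : SearchTree} (h : Runs k s t)
    {f : State → SearchTree} (hf : ∀ w ∈ t.paths, Runs k' w.2 (f w.2)) :
    Runs (k ++ k') s (t.graft f) := by
  induction h with
  | halt => exact hf (0, _) (by simp [SearchTree.paths])
  | assign _ ih =>
    exact .assign (ih fun w hw => hf (w.1 + 1, w.2) (List.mem_map_of_mem hw))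
  | store _ ih =>
    exact .store (ih fun w hw => hf (w.1 + 1, w.2) (List.mem_map_of_mem hw))
  | seq _ ih =>
    exact .seq (ih fun w hw => hf (w.1 + 1, w.2) (List.mem_map_of_mem hw))
  | ifTrue he _ ih =>
    exact .ifTrue he (ih fun w hw => hf (w.1 + 1, w.2) (List.mem_map_of_mem hw))
  | ifFalse he _ ih =>
    exact .ifFalse he (ih fun w hw => hf (w.1 + 1, w.2) (List.mem_map_of_mem hw))
  | whileTrue he _ ih =>
    exact .whileTrue he (ih fun w hw => hf (w.1 + 1, w.2) (List.mem_map_of_mem hw))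
  | whileFalse he _ ih =>
    exact .whileFalse he (ih fun w hw => hf (w.1 + 1, w.2) (List.mem_map_of_mem hw))
  | fork _ _ ih₁ ih₂ =>
    refine .fork (ih₁ fun w hw => hf (w.1 + 1, w.2) ?_) (ih₂ fun w hw => hf (w.1 + 1, w.2) ?_)
    · exact List.mem_map_of_mem (f := fun w : ℕ × State => (w.1 + 1, w.2))
        (List.mem_append_left _ hw)
    · exact List.mem_map_of_mem (f := fun w : ℕ × State => (w.1 + 1, w.2))
        (List.mem_append_right _ hw)

/-- Executing `k` from `s` ends in the states of the list `L`, along paths of length at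
most `N`. -/
def Yields (k : List Prog) (s : State) (L : List State) (N : ℕ) : Prop :=
  ∃ t, Runs k s t ∧ t.paths.map Prod.snd = L ∧ ∀ w ∈ t.paths, w.1 ≤ N

theorem Yields.mono {k : List Prog} {s : State} {L : List State} {N M : ℕ}
    (h : Yields k s L N) (hNM : N ≤ M) : Yields k s L M := by
  obtain ⟨t, ht, hL, hN⟩ := h
  exact ⟨t, ht, hL, fun w hw => (hN w hw).trans hNM⟩

theorem Yields.append {k k' : List Prog} {s : State} {L : List State} {N M : ℕ}
    {f : State → List State} (h : Yields k s L N) (hf : ∀ s' ∈ L, Yields k' s' (f s') M) :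
    Yields (k ++ k') s (L.flatMap f) (N + M) := by
  classical
  obtain ⟨t, ht, rfl, hN⟩ := h
  have hf' : ∀ s', ∃ t', s' ∈ t.paths.map Prod.snd →
      Runs k' s' t' ∧ t'.paths.map Prod.snd = f s' ∧ ∀ w ∈ t'.paths, w.1 ≤ M := by
    intro s'
    by_cases hs : s' ∈ t.paths.map Prod.snd
    · obtain ⟨t', ht'⟩ := hf s' hs
      exact ⟨t', fun _ => ht'⟩
    -- An arbitrary tree for states that occur at no leaf.
    · exact ⟨.leaf s', fun h => absurd h hs⟩
  choose F hF using hf'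
  have hF' : ∀ w ∈ t.paths, Runs k' w.2 (F w.2) ∧ (F w.2).paths.map Prod.snd = f w.2 ∧
      ∀ w' ∈ (F w.2).paths, w'.1 ≤ M := fun w hw => hF w.2 (List.mem_map_of_mem hw)
  refine ⟨t.graft F, ht.graft fun w hw => (hF' w hw).1, ?_, ?_⟩
  · rw [SearchTree.paths_graft, List.map_flatMap, List.flatMap_map]
    refine List.flatMap_congr fun w hw => ?_
    rw [← (hF' w hw).2.1, List.map_map]
    rfl
  · intro w hw
    rw [SearchTree.paths_graft] at hw
    obtain ⟨w₁, hw₁, hw⟩ := List.mem_flatMap.1 hw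
    obtain ⟨w₂, hw₂, rfl⟩ := List.mem_map.1 hw
    have h1 := hN w₁ hw₁
    have h2 := (hF' w₁ hw₁).2.2 w₂ hw₂
    simp only
    omega

theorem Yields.halt (s : State) : Yields [] s [s] 0 :=
  ⟨.leaf s, .halt, rfl, by simp [SearchTree.paths]⟩

theorem Yields.of_step {k k' : List Prog} {s s' : State} {L : List State} {N : ℕ}
    (h : Yields k s L N) (hstep : ∀ t, Runs k s t → Runs k' s' (.step t)) :
    Yields k' s' L (N + 1) := by
  obtain ⟨t, ht, rfl, hN⟩ := h
  refine ⟨.step t, hstep t ht, by simp [SearchTree.paths, Function.comp_def], ?_⟩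
  simp only [SearchTree.paths, List.mem_map, forall_exists_index, and_imp]
  rintro _ w hw rfl
  exact Nat.succ_le_succ (hN w hw)

theorem Yields.fork {p q : Prog} {k : List Prog} {s : State} {L L' : List State} {N : ℕ}
    (h : Yields (p :: k) s L N) (h' : Yields (q :: k) s L' N) :
    Yields (.fork p q :: k) s (L ++ L') (N + 1) := by
  obtain ⟨t, ht, rfl, hN⟩ := h
  obtain ⟨t', ht', rfl, hN'⟩ := h'
  refine ⟨.fork t t', .fork ht ht', by simp [SearchTree.paths, Function.comp_def], ?_⟩
  simp only [SearchTree.paths, List.mem_map, forall_exists_index, and_imp]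
  rintro _ w hw rfl
  exact Nat.succ_le_succ ((List.mem_append.1 hw).elim (hN w) (hN' w))

theorem Yields.seq {p q : Prog} {s : State} {L : List State} {N M : ℕ}
    {f : State → List State} (h : Yields [p] s L N) (hf : ∀ s' ∈ L, Yields [q] s' (f s') M) :
    Yields [.seq p q] s (L.flatMap f) (N + M + 1) :=
  (h.append hf).of_step fun _ ht => .seq ht

/-! ### Deterministic commands -/

/-- Deterministic programs; `loop x b p` executes `p` for `x = 0, …, b - 1`, where `x` and `b`
are registers. -/
inductive Cmd where
  | skip
  | assign (x : ℕ) (e : Expr)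
  | store (a : ℕ) (i e : Expr)
  | seq (p q : Cmd)
  | ite (e : Expr) (p q : Cmd)
  | loop (x b : ℕ) (p : Cmd)

namespace Cmd

/-- The program that a command stands for. -/
def toProg : Cmd → Prog
  -- There is no empty instruction; a failing test followed by a self-assignment takes two steps and
  -- changes nothing.
  | skip => .ifNZ (.const 0) (.assign 0 (.reg 0)) (.assign 0 (.reg 0))
  | assign x e => .assign x e
  | store a i e => .store a i e
  | seq p q => .seq p.toProg q.toProg
  | ite e p q => .ifNZ e p.toProg q.toProg
  | loop x b p => .seq (.assign x (.const 0)) (.whileNZ (.sub (.reg b) (.reg x))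
      (.seq p.toProg (.assign x (.add (.reg x) (.const 1)))))

/-- The state after `i` rounds of a loop with counter `x`. -/
def iter (x : ℕ) (f : State → State) (s : State) : ℕ → State
  | 0 => s.assign x 0
  | i + 1 => (f (iter x f s i)).assign x (i + 1)

/-- The effect of a command. -/
def run : Cmd → State → State
  | skip, s => s
  | assign x e, s => s.assign x (e.eval s)
  | store a i e, s => s.store a (i.eval s) (e.eval s)
  | seq p q, s => q.run (p.run s)
  | ite e p q, s => if e.eval s ≠ 0 then p.run s else q.run s
  | loop x b p, s => iter x p.run s (s.reg b)

/-- The registers that a command may change. -/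
def regs : Cmd → Finset ℕ
  | skip => ∅
  | assign x _ => {x}
  | store _ _ _ => ∅
  | seq p q => p.regs ∪ q.regs
  | ite _ p q => p.regs ∪ q.regs
  | loop x _ p => insert x p.regs

/-- The arrays that a command may change. -/
def arrs : Cmd → Finset ℕ
  | skip => ∅
  | assign _ _ => ∅
  | store a _ _ => {a}
  | seq p q => p.arrs ∪ q.arrs
  | ite _ p q => p.arrs ∪ q.arrs
  | loop _ _ p => p.arrs

/-- Loop bodies change neither the counter nor the bound, and the bounds are in registers
0 and 1. -/
def WF : Cmd → Prop
  | skip => True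
  | assign _ _ => True
  | store _ _ _ => True
  | seq p q => p.WF ∧ q.WF
  | ite _ p q => p.WF ∧ q.WF
  | loop x b p => (b = 0 ∨ b = 1) ∧ x ≠ b ∧ x ∉ p.regs ∧ b ∉ p.regs ∧ p.WF

/-- A bound for the number of steps, if the registers 0 and 1 contain at most `S`. -/
noncomputable def cost : Cmd → Polynomial ℕ
  | skip => 2
  | assign _ _ => 1
  | store _ _ _ => 1
  | seq p q => p.cost + q.cost + 1
  | ite _ p q => p.cost + q.cost + 1
  -- Each round adds the test, a `seq` and the increment; the outer `seq`, the initialization and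
  -- the last test occur once.
  | loop _ _ p => Polynomial.X * (p.cost + 3) + 3

/-! ### Frame rules, loop invariants and running times of commands -/

theorem iter_reg {x y : ℕ} {f : State → State} (hf : ∀ s, (f s).reg y = s.reg y) (hxy : y ≠ x)
    (s : State) (i : ℕ) : (iter x f s i).reg y = s.reg y := by
  induction i with
  | zero => simp [iter, State.assign, hxy]
  | succ i ih => simp [iter, State.assign, hxy, hf, ih]

theorem iter_reg_self (x : ℕ) (f : State → State) (s : State) (i : ℕ) :
    (iter x f s i).reg x = i := by
  cases i <;> simp [iter, State.assign]

theorem iter_arr {x a : ℕ} {f : State → State} (hf : ∀ s, (f s).arr a = s.arr a) (s : State)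
    (i : ℕ) : (iter x f s i).arr a = s.arr a := by
  induction i with
  | zero => rfl
  | succ i ih => exact (hf _).trans ih

theorem run_reg (p : Cmd) {y : ℕ} (hy : y ∉ p.regs) (s : State) : (p.run s).reg y = s.reg y := by
  induction p generalizing s with
  | skip => rfl
  | assign x e =>
    simp only [regs, Finset.mem_singleton] at hy
    simp [run, State.assign, hy]
  | store => rfl
  | seq p q ihp ihq =>
    simp only [regs, Finset.mem_union, not_or] at hy
    rw [run, ihq hy.2, ihp hy.1]
  | ite e p q ihp ihq =>
    simp only [regs, Finset.mem_union, not_or] at hy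
    rw [run]
    split
    · exact ihp hy.1 s
    · exact ihq hy.2 s
  | loop x b p ih =>
    simp only [regs, Finset.mem_insert, not_or] at hy
    exact iter_reg (ih hy.2) hy.1 s _

theorem run_arr (p : Cmd) {a : ℕ} (ha : a ∉ p.arrs) (s : State) : (p.run s).arr a = s.arr a := by
  induction p generalizing s with
  | skip => rfl
  | assign => rfl
  | store a' i e =>
    simp only [arrs, Finset.mem_singleton] at ha
    simp [run, State.store, ha]
  | seq p q ihp ihq =>
    simp only [arrs, Finset.mem_union, not_or] at ha
    rw [run, ihq ha.2, ihp ha.1]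
  | ite e p q ihp ihq =>
    simp only [arrs, Finset.mem_union, not_or] at ha
    rw [run]
    split
    · exact ihp ha.1 s
    · exact ihq ha.2 s
  | loop x b p ih =>
    exact iter_arr (ih ha) s _

/-- A rule for loops with an invariant. -/
theorem run_loop {x b : ℕ} {p : Cmd} {s : State} (Inv : ℕ → State → Prop)
    (h0 : Inv 0 (s.assign x 0))
    (hstep : ∀ i < s.reg b, ∀ s', s'.reg x = i → (∀ y, y ∉ insert x p.regs → s'.reg y = s.reg y) →
      (∀ a, a ∉ p.arrs → s'.arr a = s.arr a) → Inv i s' →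
      Inv (i + 1) ((p.run s').assign x (i + 1))) :
    Inv (s.reg b) ((loop x b p).run s) := by
  have : ∀ i ≤ s.reg b, Inv i (iter x p.run s i) := by
    intro i
    induction i with
    | zero => exact fun _ => h0
    | succ i ih =>
      refine fun hi => hstep i hi _ (iter_reg_self _ _ _ _) (fun y hy => ?_) (fun a ha => ?_)
        (ih (by omega))
      · rw [Finset.mem_insert, not_or] at hy
        exact iter_reg (fun s => run_reg p hy.2 s) hy.1 s i
      · exact iter_arr (fun s => run_arr p ha s) s i
  exact this _ le_rfl

theorem yields (p : Cmd) (hp : p.WF) {s : State} {S : ℕ} (h0 : s.reg 0 ≤ S) (h1 : s.reg 1 ≤ S)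
    (hp0 : 0 ∉ p.regs) (hp1 : 1 ∉ p.regs) :
    Yields [p.toProg] s [p.run s] (p.cost.eval S) := by
  induction p generalizing s with
  | skip =>
    have h : s.assign 0 (s.reg 0) = s := by simp [State.assign]
    have := (Yields.halt s).of_step (k' := [.assign 0 (.reg 0)]) (s' := s) fun t ht =>
      .assign (by rw [Expr.eval, h]; exact ht)
    refine (this.of_step fun t ht => .ifFalse rfl ht).mono ?_
    simp [cost]
  | assign x e =>
    refine ((Yields.halt _).of_step fun t ht => .assign ht).mono ?_
    simp [cost]
  | store a i e =>
    refine ((Yields.halt _).of_step fun t ht => .store ht).mono ?_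
    simp [cost]
  | seq p q ihp ihq =>
    simp only [regs, Finset.mem_union, not_or] at hp0 hp1
    have hq := ihq hp.2 (s := p.run s) (by rwa [run_reg p hp0.1]) (by rwa [run_reg p hp1.1])
      hp0.2 hp1.2
    have := (ihp hp.1 h0 h1 hp0.1 hp1.1).seq (f := fun s => [q.run s])
      (q := q.toProg) (M := q.cost.eval S) (by simpa using hq)
    exact this.mono (by simp [cost])
  | ite e p q ihp ihq =>
    simp only [regs, Finset.mem_union, not_or] at hp0 hp1
    rw [run, toProg]
    split
    · rename_i he
      refine ((ihp hp.1 h0 h1 hp0.1 hp1.1).of_step fun t ht => .ifTrue he ht).mono ?_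
      simp [cost]
    · rename_i he
      refine ((ihq hp.2 h0 h1 hp0.2 hp1.2).of_step fun t ht => .ifFalse (not_not.1 he) ht).mono ?_
      simp [cost]
  | loop x b p ih =>
    obtain ⟨hb, hxb, hx, hbp, hp⟩ := hp
    simp only [regs, Finset.mem_insert, not_or] at hp0 hp1
    have hbS : s.reg b ≤ S := by rcases hb with rfl | rfl <;> assumption
    set N := p.cost.eval S with hN
    -- Induction on the number `j` of rounds still to come.
    have key : ∀ j i, i + j = s.reg b → Yields [.whileNZ (.sub (.reg b) (.reg x))
        (.seq p.toProg (.assign x (.add (.reg x) (.const 1))))] (iter x p.run s i)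
        [iter x p.run s (s.reg b)] (j * (N + 3) + 1) := by
      intro j
      induction j with
      | zero =>
        intro i hi
        rw [← hi, Nat.add_zero]
        refine ((Yields.halt _).of_step fun t ht => .whileFalse ?_ ht).mono (by omega)
        rw [Expr.eval, Expr.eval, Expr.eval, iter_reg_self,
          iter_reg (fun s => run_reg p hbp s) hxb.symm]
        omega
      | succ j ihj =>
        intro i hi
        have hreg : ∀ y ∉ p.regs, y ≠ x → (iter x p.run s i).reg y = s.reg y := fun y hy hyx =>
          iter_reg (fun s => run_reg p hy s) hyx s i
        have hbody := ih hp (s := iter x p.run s i) (by rwa [hreg 0 hp0.2 hp0.1])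
          (by rwa [hreg 1 hp1.2 hp1.1]) hp0.2 hp1.2
        have hinc : Yields [.assign x (.add (.reg x) (.const 1))] (p.run (iter x p.run s i))
            [iter x p.run s (i + 1)] 1 := by
          refine (Yields.halt _).of_step fun t ht => .assign ?_
          have : Expr.eval (p.run (iter x p.run s i)) (.add (.reg x) (.const 1)) = i + 1 := by
            simp only [Expr.eval, run_reg p hx, iter_reg_self]
          rw [this]
          exact ht
        have hround := hbody.seq (f := fun _ => [iter x p.run s (i + 1)])
          (q := .assign x (.add (.reg x) (.const 1))) (M := 1) (by simpa using hinc)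
        have hall := hround.append (k' := [.whileNZ (.sub (.reg b) (.reg x))
          (.seq p.toProg (.assign x (.add (.reg x) (.const 1))))])
          (f := fun _ => [iter x p.run s (s.reg b)]) (M := j * (N + 3) + 1)
          (by simpa using ihj (i + 1) (by omega))
        refine (hall.of_step fun t ht => .whileTrue ?_ ht).mono ?_
        · rw [Expr.eval, Expr.eval, Expr.eval, iter_reg_self, hreg b hbp hxb.symm]
          omega
        · rw [Nat.succ_mul]
          omega
    have hinit : Yields [.assign x (.const 0)] s [iter x p.run s 0] 1 :=
      (Yields.halt _).of_step fun t ht => .assign ht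
    refine (hinit.seq (f := fun _ => [iter x p.run s (s.reg b)]) (M := s.reg b * (N + 3) + 1)
      (by simpa using key (s.reg b) 0 (Nat.zero_add _))).mono ?_
    have := Nat.mul_le_mul_right (N + 3) hbS
    simp only [cost, Polynomial.eval_add, Polynomial.eval_mul, Polynomial.eval_X,
      Polynomial.eval_ofNat, ← hN]
    omega

end Cmd
end BranchingRAM

namespace BranchingRAM

open Cmd

/-! ### The program

Registers: 3 counts the rounds, 4 and 5 run through the sets and the elements, 6 is the chosen set,
7 is its degree plus one, 8 counts, 9 says whether the chosen set is taken, and 10 whether to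
branch. Arrays: 1 is the taken family, 2 the decided sets, 3 and 4 count for each element the taken
and the undecided sets that contain it, and 5 contains the starting points of the rows. -/

/-- The entry of the incidence matrix for the set in register `x` and the element in
register 5. -/
def entry (x : ℕ) : Expr := .get 0 (.add (.get 5 (.reg x)) (.reg 5))

/-- Count in register `r` the elements that satisfy a test. -/
def scan (r : ℕ) (e : Expr) : Cmd :=
  .seq (.assign r (.const 0)) (.loop 5 0 (.ite e (.assign r (.add (.reg r) (.const 1))) .skip))

/-- Compute the rows and the numbers of sets that contain each element. -/
def initCmd : Cmd :=
  -- Without multiplication, the row starts i·n come from repeated addition.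
  .loop 4 1 (.seq (.store 5 (.add (.reg 4) (.const 1)) (.add (.get 5 (.reg 4)) (.reg 0)))
    (.loop 5 0 (.store 4 (.reg 5) (.add (.get 4 (.reg 5)) (entry 4)))))

/-- Find an undecided set of maximal degree. -/
def selectCmd : Cmd :=
  -- The value 0 in register 7 means that no candidate has been seen; storing the degree plus one
  -- lets a set of degree zero be selected.
  .seq (.assign 7 (.const 0)) (.loop 4 1 (.ite (.get 2 (.reg 4)) .skip
    (.seq (scan 8 (.sub (entry 4) (.get 3 (.reg 5))))
      (.ite (.sub (.add (.reg 8) (.const 1)) (.reg 7))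
        (.seq (.assign 6 (.reg 4)) (.assign 7 (.add (.reg 8) (.const 1)))) .skip))))

/-- Find out whether the chosen set has to be taken, and whether to branch. -/
def testCmd : Cmd :=
  -- Truncated subtraction acts as conjunction: the value is nonzero iff the element lies in the
  -- chosen set, is uncovered and has at most one option. The undecided chosen set is one option
  -- already.
  .seq (scan 9 (.sub (.sub (entry 6) (.get 3 (.reg 5))) (.sub (.get 4 (.reg 5)) (.const 1))))
    (.ite (.reg 9) (.seq (.assign 9 (.const 1)) (.assign 10 (.const 0)))
      (.assign 10 (.sub (.reg 7) (.const 1))))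

/-- Take or discard the chosen set. -/
def updateCmd : Cmd :=
  .seq (.seq (.store 1 (.reg 6) (.reg 9)) (.store 2 (.reg 6) (.const 1)))
    (.loop 5 0 (.seq
      -- The summand is the matrix entry if register 9 is 1, and 0 if it is 0.
      (.store 3 (.reg 5) (.add (.get 3 (.reg 5)) (.sub (entry 6) (.sub (.const 1) (.reg 9)))))
      (.store 4 (.reg 5) (.sub (.get 4 (.reg 5)) (entry 6)))))

/-- Check that the taken family is a minimal set cover. -/
def finalCmd : Cmd :=
  -- Register 7 counts the uncovered elements plus the taken sets without a private element, so the
  -- family is a minimal cover iff it ends at 0.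
  .seq (scan 8 (.sub (.const 1) (.get 3 (.reg 5))))
    (.seq (.assign 7 (.reg 8))
      (.seq (.loop 4 1 (.ite (.get 1 (.reg 4))
          (.seq (scan 8 (.sub (entry 4) (.sub (.get 3 (.reg 5)) (.const 1))))
            (.ite (.reg 8) .skip (.assign 7 (.add (.reg 7) (.const 1))))) .skip))
        (.assign 2 (.sub (.const 1) (.reg 7)))))

/-- The memory state `s` describes the moment when exactly the sets in `D` are decided and those
in `C` are taken. -/
structure Rep (I : SetSystem) (D C : Finset (Fin I.m)) (s : State) : Prop where
  n : s.reg 0 = I.n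
  m : s.reg 1 = I.m
  inp (i : Fin I.m) (u : Fin I.n) : s.arr 0 (i.val * I.n + u.val) = if u ∈ I.sets i then 1 else 0
  taken (i : Fin I.m) : s.arr 1 i = if i ∈ C then 1 else 0
  decided (i : Fin I.m) : s.arr 2 i = if i ∈ D then 1 else 0
  hit (u : Fin I.n) : s.arr 3 u = I.hitCount C u
  cnt (u : Fin I.n) : s.arr 4 u = (I.options D u).card
  row (i : Fin I.m) : s.arr 5 i = i.val * I.n
  sub : C ⊆ D

/-! ### The memory invariant and the counting loop -/

variable {I : SetSystem} {D C : Finset (Fin I.m)} {s : State}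

theorem Rep.congr (h : Rep I D C s) {s' : State} (hr : ∀ y < 2, s'.reg y = s.reg y)
    (ha : ∀ a < 6, s'.arr a = s.arr a) : Rep I D C s' where
  n := by rw [hr 0 (by decide), h.n]
  m := by rw [hr 1 (by decide), h.m]
  inp := by rw [ha 0 (by decide)]; exact h.inp
  taken := by rw [ha 1 (by decide)]; exact h.taken
  decided := by rw [ha 2 (by decide)]; exact h.decided
  hit := by rw [ha 3 (by decide)]; exact h.hit
  cnt := by rw [ha 4 (by decide)]; exact h.cnt
  row := by rw [ha 5 (by decide)]; exact h.row
  sub := h.sub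

theorem Rep.assign (h : Rep I D C s) {x : ℕ} (hx : 2 ≤ x) (v : ℕ) : Rep I D C (s.assign x v) :=
  h.congr (fun y hy => by simp [State.assign, (show y ≠ x by omega)]) fun _ _ => rfl

theorem Rep.run (h : Rep I D C s) (p : Cmd) (hr : ∀ y < 2, y ∉ p.regs)
    (ha : ∀ a < 6, a ∉ p.arrs) : Rep I D C (p.run s) :=
  h.congr (fun y hy => run_reg p (hr y hy) s) fun a ha' => run_arr p (ha a ha') s

theorem Rep.eval_entry_of_eq (h : Rep I D C s) {s' : State} (h0 : s'.arr 0 = s.arr 0)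
    (h5 : s'.arr 5 = s.arr 5) {x : ℕ} {i : Fin I.m} {u : Fin I.n} (hx : s'.reg x = i)
    (hu : s'.reg 5 = u) : (entry x).eval s' = if u ∈ I.sets i then 1 else 0 := by
  simp only [entry, Expr.eval, hx, hu, h0, h5, h.row, h.inp]

theorem Rep.eval_entry (h : Rep I D C s) {x : ℕ} {i : Fin I.m} {u : Fin I.n} (hx : s.reg x = i)
    (hu : s.reg 5 = u) : (entry x).eval s = if u ∈ I.sets i then 1 else 0 :=
  h.eval_entry_of_eq rfl rfl hx hu

theorem card_filter_val_lt_succ {k : ℕ} (S : Finset (Fin k)) (i : Fin k) :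
    (S.filter fun j => j.val < i.val + 1).card =
      (S.filter fun j => j.val < i.val).card + if i ∈ S then 1 else 0 := by
  have h : (S.filter fun j => j.val < i.val + 1) =
      (S.filter fun j => j.val < i.val) ∪ if i ∈ S then {i} else ∅ := by
    ext j
    rcases eq_or_ne j i with rfl | hj
    · by_cases hS : j ∈ S <;> simp [hS]
    · have : j.val ≠ i.val := fun h => hj (Fin.ext h)
      by_cases hS : i ∈ S <;> simp [hS, hj] <;> omega
  rw [h, Finset.card_union_of_disjoint]
  · split <;> simp
  · split <;> simp

theorem card_filter_val_lt_self {k : ℕ} (S : Finset (Fin k)) :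
    (S.filter fun j => j.val < k).card = S.card := by
  rw [Finset.filter_true_of_mem fun j _ => j.2]

theorem regs_scan (r : ℕ) (e : Expr) : (scan r e).regs = {r, 5} := by
  ext y
  simp only [scan, regs, Finset.mem_union, Finset.mem_insert, Finset.mem_singleton,
    Finset.notMem_empty]
  tauto

theorem arrs_scan (r : ℕ) (e : Expr) : (scan r e).arrs = ∅ := rfl

/-- The test need only be correct in states that the loop can reach: those that satisfy the
invariant and agree with `s` except in the counters `r` and 5. -/
theorem run_scan (hs : Rep I D C s) {r : ℕ} (hr : 6 ≤ r) {e : Expr} (S : Finset (Fin I.n))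
    (he : ∀ (u : Fin I.n) (s' : State), Rep I D C s' → (∀ y, y ≠ r → y ≠ 5 → s'.reg y = s.reg y) →
      s'.reg 5 = u → (e.eval s' ≠ 0 ↔ u ∈ S)) :
    ((scan r e).run s).reg r = S.card := by
  have h := run_loop (x := 5) (b := 0) (p := .ite e (.assign r (.add (.reg r) (.const 1))) .skip)
    (s := s.assign r 0) (fun i s' => s'.reg r = (S.filter fun j => j.val < i).card)
    (by simp [State.assign, (show r ≠ 5 by omega)]) (by
      intro i hi s' hx hreg harr hInv
      have h0 : (s.assign r 0).reg 0 = I.n := (hs.assign (by omega) 0).n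
      rw [h0] at hi
      have hreg' : ∀ y, y ≠ r → y ≠ 5 → s'.reg y = s.reg y := by
        intro y hyr hy5
        rw [hreg y (by simp [regs, hyr, hy5])]
        simp [State.assign, hyr]
      have hs' : Rep I D C s' := hs.congr (fun y hy => hreg' y (by omega) (by omega))
        fun a _ => harr a (by simp [arrs])
      have hiff := he ⟨i, hi⟩ s' hs' hreg' hx
      have hcard := card_filter_val_lt_succ S ⟨i, hi⟩
      simp only at hcard
      rw [hcard, ← hInv, Cmd.run]
      by_cases hmem : (⟨i, hi⟩ : Fin I.n) ∈ S
      · rw [if_pos (hiff.2 hmem), if_pos hmem]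
        simp [Cmd.run, State.assign, Expr.eval, (show r ≠ 5 by omega)]
      · rw [if_neg (fun h => hmem (hiff.1 h)), if_neg hmem]
        simp [Cmd.run, State.assign, (show r ≠ 5 by omega)])
  have h0 : (s.assign r 0).reg 0 = I.n := (hs.assign (by omega) 0).n
  rw [h0, card_filter_val_lt_self] at h
  exact h

/-! ### Correctness of selection, test, update and final check -/

theorem mem_newly_iff {u : Fin I.n} {v : Fin I.m} :
    u ∈ I.newly C v ↔ u ∈ I.sets v ∧ I.hitCount C u = 0 := by
  rw [SetSystem.newly, Finset.mem_filter, SetSystem.hitCount, Finset.card_eq_zero,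
    Finset.filter_eq_empty_iff]

/-- Running maximum over the undecided sets seen so far; as `D` is not everything, some candidate is
eventually found. -/
theorem run_selectCmd (hs : Rep I D C s) (hD : D ≠ Finset.univ) :
    ∃ v : Fin I.m, I.IsGreedyChoice D C v ∧ (selectCmd.run s).reg 6 = v ∧
      (selectCmd.run s).reg 7 = (I.newly C v).card + 1 := by
  have h := run_loop (x := 4) (b := 1) (p := .ite (.get 2 (.reg 4)) .skip
    (.seq (scan 8 (.sub (entry 4) (.get 3 (.reg 5))))
      (.ite (.sub (.add (.reg 8) (.const 1)) (.reg 7))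
        (.seq (.assign 6 (.reg 4)) (.assign 7 (.add (.reg 8) (.const 1)))) .skip)))
    (s := s.assign 7 0)
    (fun i s' => (∀ w : Fin I.m, w.val < i → w ∉ D → (I.newly C w).card + 1 ≤ s'.reg 7) ∧
      (s'.reg 7 ≠ 0 → ∃ v : Fin I.m, v ∉ D ∧ s'.reg 6 = v ∧
        s'.reg 7 = (I.newly C v).card + 1))
    (by simp [State.assign]) (by
      intro i hi s' hx hreg harr hInv
      have h1 : (s.assign 7 0).reg 1 = I.m := (hs.assign (by omega) 0).m
      rw [h1] at hi
      have hs' : Rep I D C s' := (hs.assign (x := 7) (by omega) 0).congr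
        (fun y hy => hreg y (by simp [regs, regs_scan]; omega))
        fun a _ => harr a (by simp [arrs, arrs_scan])
      obtain ⟨hmax, hex⟩ := hInv
      have hdec : s'.arr 2 i = if (⟨i, hi⟩ : Fin I.m) ∈ D then 1 else 0 := hs'.decided ⟨i, hi⟩
      by_cases hiD : (⟨i, hi⟩ : Fin I.m) ∈ D
      · rw [if_pos hiD] at hdec
        rw [Cmd.run, if_pos (by simp [Expr.eval, hx, hdec])]
        refine ⟨fun w hw hwD => ?_, hex⟩
        refine hmax w (lt_of_le_of_ne (Nat.lt_succ_iff.1 hw) fun h => hwD ?_) hwD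
        have : w = ⟨i, hi⟩ := Fin.ext h
        rwa [this]
      · rw [if_neg hiD] at hdec
        rw [Cmd.run, if_neg (by simp [Expr.eval, hx, hdec])]
        have hdeg := run_scan hs' (r := 8) (by omega) (e := .sub (entry 4) (.get 3 (.reg 5)))
          (I.newly C ⟨i, hi⟩) (by
            intro u s'' hs'' hreg'' hu
            have := hs''.eval_entry (x := 4) (i := ⟨i, hi⟩)
              (by rw [hreg'' 4 (by omega) (by omega), hx]) hu
            rw [Expr.eval, this, Expr.eval, Expr.eval, hu, hs''.hit, mem_newly_iff]
            split
            · simp_all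
              omega
            · simp_all)
        set s₁ := (scan 8 (.sub (entry 4) (.get 3 (.reg 5)))).run s' with hs₁
        have h4 : s₁.reg 4 = i := by rw [hs₁, run_reg _ (by simp [regs_scan]), hx]
        have h6 : s₁.reg 6 = s'.reg 6 := run_reg _ (by simp [regs_scan]) _
        have h7 : s₁.reg 7 = s'.reg 7 := run_reg _ (by simp [regs_scan]) _
        have hlt : ∀ w : Fin I.m, w.val < i + 1 → w = ⟨i, hi⟩ ∨ w.val < i := by
          intro w hw
          rcases Nat.lt_succ_iff_lt_or_eq.1 hw with h | h
          · exact Or.inr h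
          · exact Or.inl (Fin.ext h)
        rw [Cmd.run, ← hs₁, Cmd.run]
        by_cases hnew : (I.newly C ⟨i, hi⟩).card + 1 ≤ s'.reg 7
        · rw [if_neg (by simp only [Expr.eval, hdeg, h7]; omega)]
          have e6 : (s₁.assign 4 (i + 1)).reg 6 = s'.reg 6 := h6
          have e7 : (s₁.assign 4 (i + 1)).reg 7 = s'.reg 7 := h7
          simp only [Cmd.run, e6, e7]
          refine ⟨fun w hw hwD => ?_, hex⟩
          rcases hlt w hw with rfl | hw
          · exact hnew
          · exact hmax w hw hwD
        · rw [if_pos (by simp only [Expr.eval, hdeg, h7]; omega)]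
          have e6 : (((Cmd.seq (.assign 6 (.reg 4)) (.assign 7 (.add (.reg 8) (.const 1)))).run
              s₁).assign 4 (i + 1)).reg 6 = i := by
            simp [Cmd.run, State.assign, Expr.eval, h4]
          have e7 : (((Cmd.seq (.assign 6 (.reg 4)) (.assign 7 (.add (.reg 8) (.const 1)))).run
              s₁).assign 4 (i + 1)).reg 7 = (I.newly C ⟨i, hi⟩).card + 1 := by
            simp [Cmd.run, State.assign, Expr.eval, hdeg]
          simp only [e6, e7]
          refine ⟨fun w hw hwD => ?_, fun _ => ⟨⟨i, hi⟩, hiD, rfl, rfl⟩⟩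
          rcases hlt w hw with rfl | hw
          · exact le_rfl
          · exact (hmax w hw hwD).trans (by omega))
  have h1 : (s.assign 7 0).reg 1 = I.m := (hs.assign (by omega) 0).m
  rw [h1] at h
  obtain ⟨hmax, hex⟩ := h
  obtain ⟨w, hw⟩ : ∃ w, w ∉ D := by
    by_contra! hall
    exact hD (Finset.eq_univ_of_forall hall)
  have hw' := hmax w w.2 hw
  obtain ⟨v, hv, h6, h7⟩ := hex (by omega)
  refine ⟨v, ⟨hv, fun w hw => ?_⟩, h6, h7⟩
  have := hmax w w.2 hw
  omega

theorem run_testCmd (hs : Rep I D C s) {v : Fin I.m} (hv : v ∉ D) (h6 : s.reg 6 = v)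
    (h7 : s.reg 7 = (I.newly C v).card + 1) :
    (I.Forced D C v ∧ (testCmd.run s).reg 9 = 1 ∧ (testCmd.run s).reg 10 = 0) ∨
    (¬ I.Forced D C v ∧ (testCmd.run s).reg 9 = 0 ∧
      (testCmd.run s).reg 10 = (I.newly C v).card) := by
  have hcount := run_scan hs (r := 9) (by omega)
    (e := .sub (.sub (entry 6) (.get 3 (.reg 5))) (.sub (.get 4 (.reg 5)) (.const 1)))
    ((I.newly C v).filter fun u => (I.options D u).card = 1) (by
      intro u s'' hs'' hreg'' hu
      have := hs''.eval_entry (x := 6) (i := v)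
        (by rw [hreg'' 6 (by omega) (by omega), h6]) hu
      simp only [Expr.eval, this, hu, hs''.hit, hs''.cnt, Finset.mem_filter, mem_newly_iff]
      by_cases huv : u ∈ I.sets v
      · have : (I.options D u).card ≠ 0 := Finset.card_ne_zero_of_mem
          (Finset.mem_filter.2 ⟨Finset.mem_compl.2 hv, huv⟩)
        simp only [huv, if_true, true_and]
        omega
      · simp [huv])
  set e : Expr := .sub (.sub (entry 6) (.get 3 (.reg 5))) (.sub (.get 4 (.reg 5)) (.const 1))
    with he
  have h7' : ((scan 9 e).run s).reg 7 = (I.newly C v).card + 1 := by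
    rw [run_reg _ (by simp [regs_scan]), h7]
  rw [testCmd, ← he, Cmd.run, Cmd.run]
  by_cases hf : I.Forced D C v
  · obtain ⟨u, hu, hcard⟩ := id hf
    have : ((scan 9 e).run s).reg 9 ≠ 0 := by
      rw [hcount]
      exact Finset.card_ne_zero_of_mem (Finset.mem_filter.2 ⟨hu, hcard⟩)
    rw [if_pos (show Expr.eval _ (.reg 9) ≠ 0 from this)]
    exact Or.inl ⟨hf, by simp [Cmd.run, State.assign, Expr.eval]⟩
  · have : ((scan 9 e).run s).reg 9 = 0 := by
      rw [hcount, Finset.card_eq_zero, Finset.filter_eq_empty_iff]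
      exact fun u hu hcard => hf ⟨u, hu, hcard⟩
    rw [if_neg (show ¬ Expr.eval _ (.reg 9) ≠ 0 from not_not.2 this)]
    exact Or.inr ⟨hf, by simp [Cmd.run, State.assign, Expr.eval, this, h7']⟩

theorem hitCount_insert {v : Fin I.m} (hv : v ∉ C) (u : Fin I.n) :
    I.hitCount (insert v C) u = I.hitCount C u + if u ∈ I.sets v then 1 else 0 := by
  rw [SetSystem.hitCount, Finset.filter_insert, SetSystem.hitCount]
  split
  · rw [Finset.card_insert_of_notMem fun h => hv (Finset.mem_filter.1 h).1]
  · rfl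

theorem card_options_insert {v : Fin I.m} (hv : v ∉ D) (u : Fin I.n) :
    (I.options (insert v D) u).card = (I.options D u).card - if u ∈ I.sets v then 1 else 0 := by
  rw [SetSystem.options_insert]
  by_cases hu : u ∈ I.sets v
  · have : v ∈ I.options D u := Finset.mem_filter.2 ⟨Finset.mem_compl.2 hv, hu⟩
    rw [if_pos hu, Finset.card_erase_of_mem this]
  · have : v ∉ I.options D u := fun h => hu (Finset.mem_filter.1 h).2
    rw [if_neg hu, Finset.erase_eq_of_notMem this, Nat.sub_zero]

/-- Both outcomes are treated at once through the bit in register 9. The invariant C ⊆ D gives `v ∉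
C`, so taking `v` raises the hit counts by exactly its row. -/
theorem run_updateCmd (hs : Rep I D C s) {v : Fin I.m} (hv : v ∉ D) (h6 : s.reg 6 = v)
    {C' : Finset (Fin I.m)} (hC' : s.reg 9 = 1 ∧ C' = insert v C ∨ s.reg 9 = 0 ∧ C' = C) :
    Rep I (insert v D) C' (updateCmd.run s) := by
  have hvC : v ∉ C := fun h => hv (hs.sub h)
  have hhit : ∀ u, I.hitCount C' u =
      I.hitCount C u + ((if u ∈ I.sets v then 1 else 0) - (1 - s.reg 9)) := by
    intro u
    rcases hC' with ⟨h9, rfl⟩ | ⟨h9, rfl⟩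
    · rw [hitCount_insert hvC, h9]
      simp
    · rw [h9]
      split <;> simp
  set s₁ := (Cmd.seq (.store 1 (.reg 6) (.reg 9)) (.store 2 (.reg 6) (.const 1))).run s with hs₁
  have hreg₁ : s₁.reg = s.reg := rfl
  have harr₁ : ∀ a, a ≠ 1 → a ≠ 2 → s₁.arr a = s.arr a := by
    intro a h1 h2
    exact run_arr _ (by simp [arrs, h1, h2]) s
  have hone : s₁.arr 1 = Function.update (s.arr 1) v (s.reg 9) := by
    simp [hs₁, Cmd.run, State.store, Expr.eval, h6]
  have htwo : s₁.arr 2 = Function.update (s.arr 2) v 1 := by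
    simp [hs₁, Cmd.run, State.store, Expr.eval, h6]
  set body : Cmd := .seq
      (.store 3 (.reg 5) (.add (.get 3 (.reg 5)) (.sub (entry 6) (.sub (.const 1) (.reg 9)))))
      (.store 4 (.reg 5) (.sub (.get 4 (.reg 5)) (entry 6))) with hbody
  have hrun : updateCmd.run s = (Cmd.loop 5 0 body).run s₁ := rfl
  have hframe : ∀ a, a ≠ 1 → a ≠ 2 → a ≠ 3 → a ≠ 4 →
      (updateCmd.run s).arr a = s.arr a := by
    intro a h1 h2 h3 h4
    exact run_arr _ (by simp [updateCmd, arrs, h1, h2, h3, h4]) s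
  have h := run_loop (x := 5) (b := 0) (p := body) (s := s₁)
    (fun i s' => ∀ u : Fin I.n,
      s'.arr 3 u = (if u.val < i then I.hitCount C' u else I.hitCount C u) ∧
      s'.arr 4 u = if u.val < i then (I.options (insert v D) u).card else (I.options D u).card)
    (by
      intro u
      simp only [State.assign, harr₁ 3 (by decide) (by decide), harr₁ 4 (by decide) (by decide),
        hs.hit, hs.cnt, Nat.not_lt_zero, if_false, and_self])
    (by
      intro i hi s' hx hreg harr hInv u
      rw [hreg₁, hs.n] at hi
      have hent : ∀ s'' : State, s''.reg = s'.reg → (∀ a, a ≠ 3 → s''.arr a = s'.arr a) →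
          (entry 6).eval s'' = if (⟨i, hi⟩ : Fin I.n) ∈ I.sets v then 1 else 0 := by
        intro s'' hr'' ha''
        refine hs.eval_entry_of_eq ?_ ?_ ?_ ?_
        · rw [ha'' 0 (by decide), harr 0 (by simp [hbody, arrs]), harr₁ 0 (by decide) (by decide)]
        · rw [ha'' 5 (by decide), harr 5 (by simp [hbody, arrs]), harr₁ 5 (by decide) (by decide)]
        · rw [hr'', hreg 6 (by simp [hbody, regs]), hreg₁, h6]
        · rw [hr'', hx]
      have h9 : s'.reg 9 = s.reg 9 := by rw [hreg 9 (by simp [hbody, regs]), hreg₁]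
      have hi3 := (hInv ⟨i, hi⟩).1
      have hi4 := (hInv ⟨i, hi⟩).2
      simp only [lt_self_iff_false, if_false] at hi3 hi4
      have e3 : ((body.run s').assign 5 (i + 1)).arr 3 =
          Function.update (s'.arr 3) i (I.hitCount C' ⟨i, hi⟩) := by
        simp only [hbody, Cmd.run, State.assign, State.store, Expr.eval, hx, hi3, h9,
          hent s' rfl fun _ _ => rfl, hhit]
        simp
      have e4 : ((body.run s').assign 5 (i + 1)).arr 4 =
          Function.update (s'.arr 4) i (I.options (insert v D) ⟨i, hi⟩).card := by
        set mid := (Cmd.store 3 (.reg 5) (.add (.get 3 (.reg 5))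
          (.sub (entry 6) (.sub (.const 1) (.reg 9))))).run s' with hmid
        have hm : (entry 6).eval mid = if (⟨i, hi⟩ : Fin I.n) ∈ I.sets v then 1 else 0 :=
          hent mid rfl fun a ha => run_arr _ (by simp [arrs, ha]) s'
        have hm4 : mid.arr 4 = s'.arr 4 := run_arr _ (by simp [arrs]) s'
        have hm5 : mid.reg 5 = i := hx
        have : body.run s' = mid.store 4 (mid.reg 5) (mid.arr 4 (mid.reg 5) - (entry 6).eval mid) :=
          rfl
        rw [this, hm, hm5, hm4, hi4, card_options_insert hv]
        simp [State.store, State.assign, hm4]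
      rw [e3, e4]
      by_cases hui : u.val = i
      · obtain rfl : u = ⟨i, hi⟩ := Fin.ext hui
        simp
      · rw [Function.update_of_ne hui, Function.update_of_ne hui]
        have := hInv u
        simpa only [show (u.val < i + 1) = (u.val < i) by
          rw [eq_iff_iff]; omega] using this)
  rw [hreg₁, hs.n, ← hrun] at h
  refine ⟨?_, ?_, ?_, ?_, ?_, ?_, ?_, ?_, ?_⟩
  · rw [run_reg _ (by decide), hs.n]
  · rw [run_reg _ (by decide), hs.m]
  · rw [hframe 0 (by decide) (by decide) (by decide) (by decide)]
    exact hs.inp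
  · intro i
    rw [hrun, run_arr _ (by simp [hbody, arrs]), hone, Function.update_apply, hs.taken]
    by_cases hiv : i = v
    · subst hiv
      rcases hC' with ⟨h9, rfl⟩ | ⟨h9, rfl⟩ <;> simp [h9, hvC]
    · rw [if_neg fun h => hiv (Fin.ext h)]
      rcases hC' with ⟨h9, rfl⟩ | ⟨h9, rfl⟩ <;> simp [hiv]
  · intro i
    rw [hrun, run_arr _ (by simp [hbody, arrs]), htwo, Function.update_apply, hs.decided]
    by_cases hiv : i = v
    · simp [hiv]
    · rw [if_neg fun h => hiv (Fin.ext h)]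
      simp [hiv]
  · intro u
    rw [(h u).1, if_pos u.2]
  · intro u
    rw [(h u).2, if_pos u.2]
  · rw [hframe 5 (by decide) (by decide) (by decide) (by decide)]
    exact hs.row
  · rcases hC' with ⟨_, rfl⟩ | ⟨_, rfl⟩
    · exact Finset.insert_subset_insert _ hs.sub
    · exact hs.sub.trans (Finset.subset_insert _ _)

theorem run_finalCmd (hs : Rep I D C s) :
    (finalCmd.run s).reg 2 ≠ 0 ↔ I.IsMinimalSetCover C := by
  have huncov := run_scan hs (r := 8) (by omega) (e := .sub (.const 1) (.get 3 (.reg 5)))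
    (Finset.univ.filter fun u => I.hitCount C u = 0) (by
      intro u s' hs' _ hu
      simp only [Expr.eval, hu, hs'.hit, Finset.mem_filter, Finset.mem_univ, true_and]
      omega)
  set s₁ := (Cmd.seq (scan 8 (.sub (.const 1) (.get 3 (.reg 5)))) (.assign 7 (.reg 8))).run s
    with hs₁
  have hrep : Rep I D C s₁ := hs.run _ (by simp [regs, regs_scan]; omega) (by simp [arrs, arrs_scan])
  have h7 : s₁.reg 7 = (Finset.univ.filter fun u => I.hitCount C u = 0).card := by
    rw [← huncov]
    simp [hs₁, Cmd.run, State.assign, Expr.eval]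
  set body : Cmd := .ite (.get 1 (.reg 4))
    (.seq (scan 8 (.sub (entry 4) (.sub (.get 3 (.reg 5)) (.const 1))))
      (.ite (.reg 8) .skip (.assign 7 (.add (.reg 7) (.const 1))))) .skip with hbody
  have hrun : (finalCmd.run s).reg 2 = 1 - ((Cmd.loop 4 1 body).run s₁).reg 7 := by
    simp [finalCmd, ← hbody, hs₁, Cmd.run, State.assign, Expr.eval]
  have h := run_loop (x := 4) (b := 1) (p := body) (s := s₁)
    (fun i s' => s'.reg 7 = 0 ↔ (∀ u, I.hitCount C u ≠ 0) ∧
      ∀ w : Fin I.m, w.val < i → w ∈ C → ∃ u ∈ I.sets w, I.hitCount C u = 1)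
    (by
      have : (s₁.assign 4 0).reg 7 = s₁.reg 7 := rfl
      simp only [this, h7, Finset.card_eq_zero, Finset.filter_eq_empty_iff, Finset.mem_univ,
        true_imp_iff, Nat.not_lt_zero, false_imp_iff, implies_true, and_true, ne_eq])
    (by
      intro i hi s' hx hreg harr hInv
      rw [hrep.m] at hi
      have hs' : Rep I D C s' := hrep.congr (fun y hy => hreg y (by
        simp [hbody, regs, regs_scan]; omega)) fun a _ => harr a (by simp [hbody, arrs, arrs_scan])
      have htaken : s'.arr 1 i = if (⟨i, hi⟩ : Fin I.m) ∈ C then 1 else 0 := hs'.taken ⟨i, hi⟩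
      have hsucc : (∀ w : Fin I.m, w.val < i + 1 → w ∈ C → ∃ u ∈ I.sets w, I.hitCount C u = 1) ↔
          (∀ w : Fin I.m, w.val < i → w ∈ C → ∃ u ∈ I.sets w, I.hitCount C u = 1) ∧
          ((⟨i, hi⟩ : Fin I.m) ∈ C → ∃ u ∈ I.sets ⟨i, hi⟩, I.hitCount C u = 1) := by
        constructor
        · exact fun h => ⟨fun w hw => h w (hw.trans (Nat.lt_succ_self _)),
            h ⟨i, hi⟩ (Nat.lt_succ_self _)⟩
        · rintro ⟨h₁, h₂⟩ w hw
          rcases Nat.lt_succ_iff_lt_or_eq.1 hw with hw | hw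
          · exact h₁ w hw
          · obtain rfl : w = ⟨i, hi⟩ := Fin.ext hw
            exact h₂
      rw [hsucc, ← and_assoc, ← hInv]
      by_cases hiC : (⟨i, hi⟩ : Fin I.m) ∈ C
      · rw [if_pos hiC] at htaken
        have hcount := run_scan hs' (r := 8) (by omega)
          (e := .sub (entry 4) (.sub (.get 3 (.reg 5)) (.const 1)))
          ((I.sets ⟨i, hi⟩).filter fun u => I.hitCount C u = 1) (by
            intro u s'' hs'' hreg'' hu
            have := hs''.eval_entry (x := 4) (i := ⟨i, hi⟩)
              (by rw [hreg'' 4 (by omega) (by omega), hx]) hu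
            simp only [Expr.eval, this, hu, hs''.hit, Finset.mem_filter]
            by_cases hui : u ∈ I.sets ⟨i, hi⟩
            · have : I.hitCount C u ≠ 0 := Finset.card_ne_zero_of_mem
                (Finset.mem_filter.2 ⟨hiC, hui⟩)
              simp only [hui, if_true, true_and]
              omega
            · simp [hui])
        set s₂ := (scan 8 (.sub (entry 4) (.sub (.get 3 (.reg 5)) (.const 1)))).run s' with hs₂
        have h7' : s₂.reg 7 = s'.reg 7 := run_reg _ (by simp [regs_scan]) _
        have hbr : body.run s' =
            (Cmd.ite (.reg 8) .skip (.assign 7 (.add (.reg 7) (.const 1)))).run s₂ := by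
          rw [hbody, Cmd.run, if_pos (by simp [Expr.eval, hx, htaken]), Cmd.run]
        rw [hbr, Cmd.run]
        by_cases hex : ∃ u ∈ I.sets ⟨i, hi⟩, I.hitCount C u = 1
        · obtain ⟨u, hu, hu1⟩ := id hex
          have h8 : s₂.reg 8 ≠ 0 := by
            rw [hcount]
            exact Finset.card_ne_zero_of_mem (Finset.mem_filter.2 ⟨hu, hu1⟩)
          rw [if_pos (show Expr.eval _ (.reg 8) ≠ 0 from h8)]
          have : ((Cmd.skip.run s₂).assign 4 (i + 1)).reg 7 = s'.reg 7 := h7'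
          simp [this, hex]
        · have h8 : s₂.reg 8 = 0 := by
            rw [hcount, Finset.card_eq_zero, Finset.filter_eq_empty_iff]
            exact fun u hu hu1 => hex ⟨u, hu, hu1⟩
          rw [if_neg (show ¬ Expr.eval _ (.reg 8) ≠ 0 from not_not.2 h8)]
          simp [Cmd.run, State.assign, Expr.eval, hiC, hex]
      · rw [if_neg hiC] at htaken
        have hbr : body.run s' = s' := by
          rw [hbody, Cmd.run, if_neg (by simp [Expr.eval, hx, htaken]), Cmd.run]
        have : ((body.run s').assign 4 (i + 1)).reg 7 = s'.reg 7 := by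
          rw [hbr]
          rfl
        simp [this, hiC])
  rw [hrep.m] at h
  rw [hrun, SetSystem.isMinimalSetCover_iff]
  have hall : (∀ w : Fin I.m, w.val < I.m → w ∈ C → ∃ u ∈ I.sets w, I.hitCount C u = 1) ↔
      ∀ w ∈ C, ∃ u ∈ I.sets w, I.hitCount C u = 1 :=
    ⟨fun h w => h w w.2, fun h w _ => h w⟩
  rw [hall] at h
  rw [← h]
  omega

/-! ### Initialization -/

/-- Division by n recovers the row from the address, so distinct incidences have distinct addresses.
-/
theorem inputState_entry (I : SetSystem) (i : Fin I.m) (u : Fin I.n) :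
    (inputState I).arr 0 (i.val * I.n + u.val) = if u ∈ I.sets i then 1 else 0 := by
  have : (∃ (i' : Fin I.m) (u' : Fin I.n), u' ∈ I.sets i' ∧
      i.val * I.n + u.val = i'.val * I.n + u'.val) ↔ u ∈ I.sets i := by
    constructor
    · rintro ⟨i', u', hu', h⟩
      have hpos : 0 < I.n := u.pos
      have hi : i = i' := by
        have := congrArg (· / I.n) h
        simp only [Nat.mul_comm _ I.n, Nat.mul_add_div hpos, Nat.div_eq_of_lt u.2,
          Nat.div_eq_of_lt u'.2, Nat.add_zero] at this
        exact Fin.ext this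
      subst hi
      have hu : u = u' := Fin.ext (Nat.add_left_cancel h)
      rwa [hu]
    · exact fun h => ⟨i, u, h, rfl⟩
  simp only [inputState, true_and, this]

theorem run_initCmd (I : SetSystem) : Rep I ∅ ∅ (initCmd.run (inputState I)) := by
  set inner : Cmd := .store 4 (.reg 5) (.add (.get 4 (.reg 5)) (entry 4)) with hinner
  set row : Cmd := .store 5 (.add (.reg 4) (.const 1)) (.add (.get 5 (.reg 4)) (.reg 0)) with hrow
  set s := inputState I with hs
  have hn : s.reg 0 = I.n := rfl
  have hm : s.reg 1 = I.m := rfl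
  have hrun : initCmd.run s = (Cmd.loop 4 1 (.seq row (.loop 5 0 inner))).run s := rfl
  have hframe : ∀ a, a ≠ 4 → a ≠ 5 → (initCmd.run s).arr a = s.arr a := fun a h4 h5 =>
    run_arr _ (by simp [initCmd, arrs, h4, h5]) s
  have h := run_loop (x := 4) (b := 1) (p := .seq row (.loop 5 0 inner)) (s := s)
    (fun i s' => (∀ k ≤ i, s'.arr 5 k = k * I.n) ∧ ∀ u : Fin I.n,
      s'.arr 4 u = ((I.options ∅ u).filter fun j => j.val < i).card)
    (by
      refine ⟨fun k hk => ?_, fun u => ?_⟩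
      · obtain rfl := Nat.le_zero.1 hk
        simp [State.assign, hs, inputState]
      · simp [State.assign, hs, inputState])
    (by
      intro i hi s' hx hreg harr ⟨hInv5, hInv4⟩
      rw [hm] at hi
      set s₁ := row.run s' with hs₁
      have hn₁ : s₁.reg 0 = I.n := by
        rw [hs₁, run_reg _ (by simp [hrow, regs]), hreg 0 (by simp [hrow, hinner, regs]), hn]
      have hx₁ : s₁.reg 4 = i := by rw [hs₁, run_reg _ (by simp [hrow, regs]), hx]
      have h5₁ : s₁.arr 5 = Function.update (s'.arr 5) (i + 1) ((i + 1) * I.n) := by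
        rw [hs₁, hrow]
        simp only [Cmd.run, State.store, Expr.eval, hx, hInv5 i le_rfl,
          hreg 0 (by simp [hrow, hinner, regs]), hn, Function.update_self]
        rw [Nat.succ_mul]
      have h4₁ : s₁.arr 4 = s'.arr 4 := run_arr _ (by simp [hrow, arrs]) s'
      have h0₁ : s₁.arr 0 = s.arr 0 := by
        rw [hs₁, run_arr _ (by simp [hrow, arrs]), harr 0 (by simp [hrow, hinner, arrs])]
      have hin := run_loop (x := 5) (b := 0) (p := inner) (s := s₁)
        (fun j s'' => ∀ u : Fin I.n, s''.arr 4 u =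
          if u.val < j then ((I.options ∅ u).filter fun k => k.val < i + 1).card
          else ((I.options ∅ u).filter fun k => k.val < i).card)
        (by
          intro u
          simp only [Nat.not_lt_zero, if_false, ← hInv4, ← h4₁]
          rfl)
        (by
          intro j hj s'' hx'' hreg'' harr'' hInv u
          rw [hn₁] at hj
          have hent : (entry 4).eval s'' = if (⟨j, hj⟩ : Fin I.n) ∈ I.sets ⟨i, hi⟩ then 1 else 0 := by
            simp only [entry, Expr.eval, hx'', hreg'' 4 (by simp [hinner, regs]), hx₁,
              harr'' 0 (by simp [hinner, arrs]), h0₁, harr'' 5 (by simp [hinner, arrs]), h5₁]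
            -- The write of this round went to index i + 1, so the start of row i is intact.
            rw [Function.update_of_ne (by omega), hInv5 i le_rfl]
            exact inputState_entry I ⟨i, hi⟩ ⟨j, hj⟩
          have hmem : (⟨i, hi⟩ : Fin I.m) ∈ I.options ∅ ⟨j, hj⟩ ↔
              (⟨j, hj⟩ : Fin I.n) ∈ I.sets ⟨i, hi⟩ := by
            simp [SetSystem.options]
          have hcard := card_filter_val_lt_succ (I.options ∅ ⟨j, hj⟩) ⟨i, hi⟩
          simp only [hmem] at hcard
          have hj4 := hInv ⟨j, hj⟩
          simp only [lt_self_iff_false, if_false] at hj4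
          have e4 : ((inner.run s'').assign 5 (j + 1)).arr 4 = Function.update (s''.arr 4) j
              ((I.options ∅ ⟨j, hj⟩).filter fun k => k.val < i + 1).card := by
            rw [hcard, ← hent, ← hj4]
            simp only [hinner, Cmd.run, State.store, State.assign, Expr.eval, hx'',
              Function.update_self]
          rw [e4]
          by_cases huj : u.val = j
          · obtain rfl : u = ⟨j, hj⟩ := Fin.ext huj
            simp
          · rw [Function.update_of_ne huj, hInv u]
            simp only [show (u.val < j + 1) = (u.val < j) by rw [eq_iff_iff]; omega])
      rw [hn₁] at hin
      refine ⟨fun k hk => ?_, fun u => ?_⟩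
      · have : (((Cmd.seq row (.loop 5 0 inner)).run s').assign 4 (i + 1)).arr 5 = s₁.arr 5 :=
          run_arr (.loop 5 0 inner) (by simp [hinner, arrs]) s₁
        rw [this, h5₁]
        rcases Nat.le_succ_iff.1 hk with hk | rfl
        · rw [Function.update_of_ne (by omega), hInv5 k hk]
        · rw [Function.update_self]
      · exact (hin u).trans (if_pos u.2))
  rw [hm, ← hrun] at h
  refine ⟨?_, ?_, ?_, ?_, ?_, ?_, ?_, ?_, ?_⟩
  · rw [run_reg _ (by decide), hn]
  · rw [run_reg _ (by decide), hm]
  · rw [hframe 0 (by decide) (by decide)]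
    exact inputState_entry I
  · intro i
    rw [hframe 1 (by decide) (by decide)]
    simp [hs, inputState]
  · intro i
    rw [hframe 2 (by decide) (by decide)]
    simp [hs, inputState]
  · intro u
    rw [hframe 3 (by decide) (by decide)]
    simp [hs, inputState, SetSystem.hitCount]
  · intro u
    rw [h.2, card_filter_val_lt_self]
  · exact fun i => h.1 i i.2.le
  · exact Finset.Subset.refl _

end BranchingRAM

namespace BranchingRAM

open Cmd

/-! ### The main loop -/

/-- The branching instruction of a round. -/
def guessProg : Prog :=
  -- Register 9 is overwritten only when branching; otherwise it keeps the decision of `testCmd`,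
  -- and the assignment to register 10 is idle.
  .ifNZ (.reg 10) (.fork (.assign 9 (.const 1)) (.assign 9 (.const 0))) (.assign 10 (.const 0))

/-- The deterministic parts of a round before and after branching. -/
def beforeCmd : Cmd := .seq selectCmd testCmd

/-- The part of a round after branching. -/
def afterCmd : Cmd := .seq updateCmd (.assign 3 (.add (.reg 3) (.const 1)))

/-- One round: decide one set. -/
def roundProg : Prog := .seq beforeCmd.toProg (.seq guessProg afterCmd.toProg)

/-- All rounds. -/
def roundsProg : Prog := .whileNZ (.sub (.reg 1) (.reg 3)) roundProg

/-- The greedy branching algorithm that enumerates the minimal set covers. -/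
def enumProg : Prog := .seq initCmd.toProg (.seq roundsProg finalCmd.toProg)

/-- The number of steps of one round. -/
noncomputable def roundCost : Polynomial ℕ := beforeCmd.cost + (3 + afterCmd.cost + 1) + 1

/-- The number of steps of the algorithm on one path. -/
noncomputable def enumCost : Polynomial ℕ :=
  initCmd.cost + (Polynomial.X * (roundCost + 1) + 1 + finalCmd.cost + 1) + 1

theorem size_bounds (I : SetSystem) : I.n ≤ I.size ∧ I.m ≤ I.size := by
  unfold SetSystem.size
  omega

variable {I : SetSystem} {D C : Finset (Fin I.m)} {s : State}

theorem Rep.yields (hs : Rep I D C s) (p : Cmd) (hp : p.WF) (hp0 : 0 ∉ p.regs) (hp1 : 1 ∉ p.regs) :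
    Yields [p.toProg] s [p.run s] (p.cost.eval I.size) :=
  p.yields hp (hs.n.trans_le (size_bounds I).1) (hs.m.trans_le (size_bounds I).2) hp0 hp1

theorem run_beforeCmd (hs : Rep I D C s) (hD : D ≠ Finset.univ) :
    ∃ v : Fin I.m, I.IsGreedyChoice D C v ∧ (beforeCmd.run s).reg 6 = v ∧
      ((I.Forced D C v ∧ (beforeCmd.run s).reg 9 = 1 ∧ (beforeCmd.run s).reg 10 = 0) ∨
      (¬ I.Forced D C v ∧ (beforeCmd.run s).reg 9 = 0 ∧
        (beforeCmd.run s).reg 10 = (I.newly C v).card)) := by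
  obtain ⟨v, hv, h6, h7⟩ := run_selectCmd hs hD
  have hs' : Rep I D C (selectCmd.run s) := hs.run _ (by decide) (by decide)
  refine ⟨v, hv, ?_, run_testCmd hs' hv.1 h6 h7⟩
  rw [← h6]
  exact run_reg testCmd (by decide) _

theorem yields_afterCmd (hs : Rep I D C s) {v : Fin I.m} (hv : v ∉ D) (h6 : s.reg 6 = v)
    {C' : Finset (Fin I.m)} (hC' : s.reg 9 = 1 ∧ C' = insert v C ∨ s.reg 9 = 0 ∧ C' = C)
    (h3 : s.reg 3 = D.card) :
    Rep I (insert v D) C' (afterCmd.run s) ∧ (afterCmd.run s).reg 3 = (insert v D).card ∧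
      Yields [afterCmd.toProg] s [afterCmd.run s] (afterCmd.cost.eval I.size) := by
  refine ⟨(run_updateCmd hs hv h6 hC').assign (by decide) _, ?_,
    hs.yields _ (by simp [afterCmd, updateCmd, WF, regs]) (by decide) (by decide)⟩
  have : (updateCmd.run s).reg 3 = D.card := by rw [run_reg _ (by decide), h3]
  simp [afterCmd, Cmd.run, State.assign, Expr.eval, this, Finset.card_insert_of_notMem hv]

/-- The remaining rounds carry out the greedy procedure. -/
theorem yields_roundsProg (j : ℕ) (hs : Rep I D C s) (h3 : s.reg 3 = D.card)
    (hj : D.card + j = I.m) :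
    ∃ L Ls, I.GreedyTree D C L ∧ List.Forall₂ (fun s C => Rep I Finset.univ C s) Ls L ∧
      Yields [roundsProg] s Ls (j * (roundCost.eval I.size + 1) + 1) := by
  induction j generalizing D C s with
  | zero =>
    have hD : D = Finset.univ := by
      rw [← Finset.card_eq_iff_eq_univ, Fintype.card_fin]
      exact hj
    subst hD
    refine ⟨[C], [s], .leaf, .cons hs .nil, ?_⟩
    refine ((Yields.halt s).of_step fun t ht => .whileFalse ?_ ht).mono (by omega)
    simp only [Expr.eval, hs.m, h3]
    omega
  | succ j ih =>
    have hD : D ≠ Finset.univ := by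
      rintro rfl
      rw [Finset.card_univ, Fintype.card_fin] at hj
      omega
    have htest : (Expr.sub (.reg 1) (.reg 3)).eval s ≠ 0 := by
      simp only [Expr.eval, hs.m, h3]
      omega
    have hbefore := hs.yields beforeCmd
      (by simp [beforeCmd, selectCmd, testCmd, scan, WF, regs]) (by decide) (by decide)
    obtain ⟨v, hv, h6, hcase⟩ := run_beforeCmd hs hD
    have hs₁ : Rep I D C (beforeCmd.run s) := hs.run _ (by decide) (by decide)
    have h3₁ : (beforeCmd.run s).reg 3 = D.card := by rw [run_reg _ (by decide), h3]
    have hcard : (insert v D).card + j = I.m := by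
      rw [Finset.card_insert_of_notMem hv.1]
      omega
    set s₁ := beforeCmd.run s
    -- combine a guess, the rest of the round, and the remaining rounds
    have combine : ∀ (Lg : List State) (fa fr : State → List State),
        Yields [guessProg] s₁ Lg 3 →
        (∀ s' ∈ Lg, Yields [afterCmd.toProg] s' (fa s') (afterCmd.cost.eval I.size)) →
        (∀ s' ∈ Lg, ∀ s'' ∈ fa s', Yields [roundsProg] s'' (fr s'')
          (j * (roundCost.eval I.size + 1) + 1)) →
        Yields [roundsProg] s ((Lg.flatMap fa).flatMap fr)
          ((j + 1) * (roundCost.eval I.size + 1) + 1) := by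
      intro Lg fa fr hg ha hr
      have h1 : Yields [roundProg] s (Lg.flatMap fa) (roundCost.eval I.size) := by
        have := hbefore.seq (f := fun _ => Lg.flatMap fa) (by simpa using hg.seq ha)
        refine Eq.mp ?_ this
        congr 1
        · simp
        · simp [roundCost]
      have h2 := h1.append (k' := [roundsProg]) (f := fr) (by
        intro s'' hs''
        obtain ⟨s', hs', hs''⟩ := List.mem_flatMap.1 hs''
        exact hr s' hs' s'' hs'')
      refine (h2.of_step fun t ht => .whileTrue htest ht).mono ?_
      rw [Nat.succ_mul]
      omega
    -- the same, when there is no branching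
    have single : ∀ C', (s₁.reg 9 = 1 ∧ C' = insert v C ∨ s₁.reg 9 = 0 ∧ C' = C) →
        s₁.reg 10 = 0 → ∃ L Ls, I.GreedyTree (insert v D) C' L ∧
          List.Forall₂ (fun s C => Rep I Finset.univ C s) Ls L ∧
          Yields [roundsProg] s Ls ((j + 1) * (roundCost.eval I.size + 1) + 1) := by
      intro C' hC' h10
      obtain ⟨ha₁, ha₂, ha₃⟩ := yields_afterCmd (hs₁.assign (x := 10) (by decide) 0) hv.1 h6 hC' h3₁
      obtain ⟨L, Ls, hL, hLs, hy⟩ := ih ha₁ ha₂ hcard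
      refine ⟨L, Ls, hL, hLs, ?_⟩
      have hg : Yields [guessProg] s₁ [s₁.assign 10 0] 3 :=
        (((Yields.halt _).of_step (k' := [.assign 10 (.const 0)]) (s' := s₁)
          fun t ht => .assign ht).of_step fun t ht => .ifFalse (e := .reg 10) h10 ht).mono (by decide)
      simpa using combine _ (fun _ => [afterCmd.run (s₁.assign 10 0)]) (fun _ => Ls) hg
        (by simpa using ha₃) (by simpa using hy)
    rcases hcase with ⟨hf, h9, h10⟩ | ⟨hf, h9, h10⟩
    · obtain ⟨L, Ls, hL, hLs, hy⟩ := single (insert v C) (Or.inl ⟨h9, rfl⟩) h10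
      exact ⟨L, Ls, .take hv hf hL, hLs, hy⟩
    · by_cases h0 : (I.newly C v).card = 0
      · obtain ⟨L, Ls, hL, hLs, hy⟩ := single C (Or.inr ⟨h9, rfl⟩) (h10.trans h0)
        exact ⟨L, Ls, .skip hv h0 hL, hLs, hy⟩
      · obtain ⟨ha₁, ha₂, ha₃⟩ := yields_afterCmd (hs₁.assign (x := 9) (by decide) 1) hv.1 h6
          (Or.inl ⟨rfl, rfl⟩) h3₁
        obtain ⟨hb₁, hb₂, hb₃⟩ := yields_afterCmd (hs₁.assign (x := 9) (by decide) 0) hv.1 h6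
          (Or.inr ⟨rfl, rfl⟩) h3₁
        obtain ⟨L₁, Ls₁, hL₁, hLs₁, hy₁⟩ := ih ha₁ ha₂ hcard
        obtain ⟨L₀, Ls₀, hL₀, hLs₀, hy₀⟩ := ih hb₁ hb₂ hcard
        refine ⟨L₁ ++ L₀, Ls₁ ++ Ls₀, .branch hv h0 hf hL₁ hL₀, List.rel_append hLs₁ hLs₀, ?_⟩
        have hassign : ∀ c, Yields [.assign 9 (.const c)] s₁ [s₁.assign 9 c] 1 := fun c =>
          (Yields.halt _).of_step fun t ht => .assign ht
        have hg : Yields [guessProg] s₁ ([s₁.assign 9 1] ++ [s₁.assign 9 0]) 3 :=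
          ((hassign 1).fork (hassign 0)).of_step fun t ht => .ifTrue (e := .reg 10) (h10.trans_ne h0) ht
        classical
        -- `combine` expects continuations as functions of the state, so the two children must be
        -- told apart; array 1 differs at `v`.
        have hne : (afterCmd.run (s₁.assign 9 1)) ≠ afterCmd.run (s₁.assign 9 0) := by
          intro heq
          have h1 := ha₁.taken v
          rw [heq, hb₁.taken v, if_pos (Finset.mem_insert_self _ _),
            if_neg fun h => hv.1 (hs.sub h)] at h1
          exact absurd h1 (by decide)
        have := combine _ (fun s' => [afterCmd.run s'])
          (fun s' => if s' = afterCmd.run (s₁.assign 9 1) then Ls₁ else Ls₀) hg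
          (by simpa using ⟨ha₃, hb₃⟩) (by simpa [hne.symm] using ⟨hy₁, hy₀⟩)
        simpa [hne.symm] using this

/-- The algorithm carries out the greedy procedure and checks the families that it finds. -/
theorem yields_enumProg (I : SetSystem) :
    ∃ L Ls, I.GreedyTree ∅ ∅ L ∧ List.Forall₂ (fun s C => Rep I Finset.univ C s) Ls L ∧
      Yields [enumProg] (inputState I) (Ls.map finalCmd.run) (enumCost.eval I.size) := by
  have hinit := initCmd.yields (by simp [initCmd, WF, regs]) (s := inputState I)
    (show I.n ≤ I.size from (size_bounds I).1) (show I.m ≤ I.size from (size_bounds I).2)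
    (by decide) (by decide)
  have h3 : (initCmd.run (inputState I)).reg 3 = (∅ : Finset (Fin I.m)).card := by
    rw [run_reg _ (by decide)]
    rfl
  obtain ⟨L, Ls, hL, hLs, hy⟩ := yields_roundsProg I.m (run_initCmd I) h3 (by simp)
  refine ⟨L, Ls, hL, hLs, ?_⟩
  have hrest := hy.seq (q := finalCmd.toProg) (f := fun s => [finalCmd.run s])
    (M := finalCmd.cost.eval I.size) (by
      intro s' hs'
      obtain ⟨C, hC⟩ : ∃ C, Rep I Finset.univ C s' := by
        obtain ⟨i, hi, rfl⟩ := List.mem_iff_getElem.1 hs'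
        exact ⟨_, hLs.get hi (hLs.length_eq ▸ hi)⟩
      exact hC.yields finalCmd (by simp [finalCmd, scan, WF, regs]) (by decide) (by decide))
  have := hinit.seq (f := fun _ => Ls.flatMap fun s => [finalCmd.run s]) (by simpa using hrest)
  rw [List.map_eq_flatMap]
  refine (Eq.mp (by congr 1; simp) this : Yields [enumProg] (inputState I)
    (Ls.flatMap fun s => [finalCmd.run s]) _).mono ?_
  simp only [enumCost, Polynomial.eval_add, Polynomial.eval_mul, Polynomial.eval_X,
    Polynomial.eval_one]
  have := Nat.mul_le_mul_right (roundCost.eval I.size + 1) (size_bounds I).2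
  omega

/-! ### Outputs, number of leaves and total time -/

theorem output_run_finalCmd (hs : Rep I D C s) {K : Finset (Fin I.m)} :
    output I (finalCmd.run s) = some K ↔ C = K ∧ I.IsMinimalSetCover C := by
  have harr : (finalCmd.run s).arr 1 = s.arr 1 := run_arr _ (by decide) s
  have hfam : (Finset.univ.filter fun i : Fin I.m => (finalCmd.run s).arr 1 i.val ≠ 0) = C := by
    ext i
    simp [harr, hs.taken]
  rw [output, hfam, ← run_finalCmd hs]
  by_cases h : (finalCmd.run s).reg 2 = 0 <;> simp [h]

/-- Completeness of the greedy procedure gives every minimal cover a leaf, and the final check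
silences the other leaves. Leaves of the search tree and of the greedy tree correspond one to one.
-/
theorem exists_searchTree (I : SetSystem) :
    ∃ L t, I.GreedyTree ∅ ∅ L ∧ IsSearchTree enumProg I t ∧ EnumeratesMinimalSetCovers I t ∧
      t.paths.length = L.length ∧ ∀ w ∈ t.paths, w.1 ≤ enumCost.eval I.size := by
  obtain ⟨L, Ls, hL, hLs, t, ht, hpaths, hN⟩ := yields_enumProg I
  refine ⟨L, t, hL, ht, fun K => ?_, ?_, hN⟩
  · have h1 : (∃ w ∈ t.paths, output I w.2 = some K) ↔
        ∃ s ∈ Ls, output I (finalCmd.run s) = some K := by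
      have : (∃ w ∈ t.paths, output I w.2 = some K) ↔
          ∃ s ∈ t.paths.map Prod.snd, output I s = some K := by
        simp only [List.mem_map, exists_exists_and_eq_and]
      rw [this, hpaths]
      simp
    rw [h1]
    constructor
    · rintro ⟨s, hs, hout⟩
      obtain ⟨i, hi, rfl⟩ := List.mem_iff_getElem.1 hs
      obtain ⟨rfl, hmin⟩ := (output_run_finalCmd (hLs.get hi (hLs.length_eq ▸ hi))).1 hout
      exact hmin
    · intro hK
      obtain ⟨i, hi, rfl⟩ := List.mem_iff_getElem.1
        (hL.mem_of_isMinimalSetCover hK (Finset.inter_empty K))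
      have hi' : i < Ls.length := hLs.length_eq ▸ hi
      exact ⟨Ls[i], List.getElem_mem hi', (output_run_finalCmd (hLs.get hi' hi)).2 ⟨rfl, hK⟩⟩
  · rw [← hLs.length_eq, ← List.length_map (f := Prod.snd), hpaths, List.length_map]

theorem SearchTree.time_le {t : SearchTree} {N : ℕ} (h : ∀ w ∈ t.paths, w.1 ≤ N) :
    t.time ≤ t.paths.length * N := by
  have := List.sum_le_card_nsmul (t.paths.map Prod.fst) N (by simpa using fun a b hab => h (a, b) hab)
  simpa [SearchTree.time] using this

end BranchingRAM

theorem mainTheorem5 :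
    ∃ A : BranchingRAM.Prog, BranchingRAM.IsSimpleBranchingAlgorithm A ∧
      ∀ r : ℝ, 0 < r → ∃ ε : ℝ, 0 < ε ∧ ∃ q : Polynomial ℕ,
        ∀ I : SetSystem, (I.n : ℝ) ≤ r * (I.m : ℝ) →
          ∃ t : BranchingRAM.SearchTree, BranchingRAM.IsSearchTree A I t ∧
            BranchingRAM.EnumeratesMinimalSetCovers I t ∧
            (t.time : ℝ) ≤ ((q.eval I.size : ℕ) : ℝ) * (2 : ℝ) ^ ((1 - ε) * (I.m : ℝ)) := by
  refine ⟨BranchingRAM.enumProg, ⟨BranchingRAM.enumCost, fun I => ?_⟩, fun r hr => ?_⟩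
  · obtain ⟨L, t, _, ht, _, _, hN⟩ := BranchingRAM.exists_searchTree I
    exact ⟨t, ht, hN⟩
  · obtain ⟨ε, hε, hlen⟩ := SetSystem.exists_length_le_of_density hr
    -- Total time is at most the number of leaves times the depth; the 3 is the constant in the leaf
    -- bound.
    refine ⟨ε, hε, 3 * BranchingRAM.enumCost, fun I hI => ?_⟩
    obtain ⟨L, t, hL, ht, henum, hcard, hN⟩ := BranchingRAM.exists_searchTree I
    refine ⟨t, ht, henum, ?_⟩
    have h1 : (t.time : ℝ) ≤ L.length * (BranchingRAM.enumCost.eval I.size : ℕ) := by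
      rw [← hcard]
      exact_mod_cast BranchingRAM.SearchTree.time_le hN
    have h2 := mul_le_mul_of_nonneg_right (hlen I L hL hI)
      (Nat.cast_nonneg (α := ℝ) (BranchingRAM.enumCost.eval I.size))
    rw [Polynomial.eval_mul, Polynomial.eval_ofNat, Nat.cast_mul, Nat.cast_ofNat]
    linarith
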